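/- Multiple-processor multitask scheduling (MPMS): there are $N\ge 2$ identical machines and a finite nonempty family of jobs arriving online; job $i$ is released at time $r_i\ge 0$ and consists of $n_i\ge1$ tasks with processing times $p_{i,\ell}>0$, each task being either preemptive or non-preemptive (a non-preemptive task, once started, runs on its machine to completion without interruption). A machine processes at most one task at a time, a task is processed on at most one machine at a time, and different tasks of one job may be processed in parallel. All information about job $i$ is unknown before $r_i$ and known from then on. The completion time $C_i$ of job $i$ is the maximum of the completion times of its tasks, and the cost is the total response time $\sum_i (C_i-r_i)$. With $p_i=\sum_\ell p_{i,\ell}$, let $\alpha=\max_i p_i/\min_i p_i$, let $\eta$ be the maximum processing time of a non-preemptive task ($\eta=0$ if there is none), and let $\beta=\eta/\min_i p_i$; thus $\alpha\ge 1$ and $0\le\beta\le\alpha$. A (deterministic) online algorithm is work-conserving if, whenever some machine is idle, every released unfinished task is being processed. For an online algorithm $\mathcal A$ on $N$ machines let $\mathcal{CR}_{\mathcal A}(\alpha,\beta)$ be the supremum, over all instances with parameters $\alpha$ and $\beta$, of the ratio of the cost of $\mathcal A$ to the optimal offline cost (the infimum of the cost over all feasible schedules on $N$ machines). Proposition. Every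 work-conserving algorithm for MPMS has competitive ratio $\Omega(\ln\alpha+\beta^{1-\varepsilon})$ for every $\varepsilon>0$. That is: for every $\varepsilon>0$ there is a constant $c>0$, depending only on $\varepsilon$, such that for every $N\ge 2$, every work-conserving online algorithm $\mathcal A$ on $N$ machines, and all real $\alpha\ge 1$ and $0\le\beta\le\alpha$ (with $\beta\ge 1$ in case $\varepsilon>1$), $$\mathcal{CR}_{\mathcal A}(\alpha,\beta)\ \ge\ c\,\bigl(\ln\alpha+\beta^{1-\varepsilon}\bigr).$$ -/

import Mathlib

open MeasureTheory

noncomputable section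

namespace MPMS

/-- A task: its processing time, and whether it may be interrupted. -/
structure Task where
  size : ℝ
  size_pos : 0 < size
  preemptive : Bool

/-- A job: its release date and its (nonempty) list of tasks. -/
structure Job where
  release : ℝ
  release_nonneg : 0 ≤ release
  tasks : List Task
  tasks_ne_nil : tasks ≠ []

/-- The workload of a job is the total processing time of its tasks. -/
def Job.workload (J : Job) : ℝ := (J.tasks.map Task.size).sum

/-- An input instance: a nonempty finite family of jobs, numbered in the order of release
(so that the number of a job reveals nothing about jobs that are released later). -/
structure Instance where
  jobs : List Job
  jobs_ne_nil : jobs ≠ []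
  sorted : jobs.Pairwise (fun J J' => J.release ≤ J'.release)

/-- `ω.HasTask τ J T`: task number `τ.2` of job number `τ.1` of the instance is `T`, and that job
is `J`. -/
def Instance.HasTask (ω : Instance) (τ : ℕ × ℕ) (J : Job) (T : Task) : Prop :=
  ω.jobs[τ.1]? = some J ∧ J.tasks[τ.2]? = some T

/-- The maximum job workload. -/
def Instance.maxWorkload (ω : Instance) : ℝ :=
  sSup {x | ∃ J ∈ ω.jobs, x = J.workload}

/-- The minimum job workload. -/
def Instance.minWorkload (ω : Instance) : ℝ :=
  sInf {x | ∃ J ∈ ω.jobs, x = J.workload}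

/-- The maximum processing time `η` of a non-preemptive task (`0` if there is none). -/
def Instance.eta (ω : Instance) : ℝ :=
  sSup {x | ∃ J ∈ ω.jobs, ∃ T ∈ J.tasks, T.preemptive = false ∧ x = T.size}

/-- The parameter `α`: ratio of the maximum to the minimum job workload. -/
def Instance.alpha (ω : Instance) : ℝ := ω.maxWorkload / ω.minWorkload

/-- The parameter `β`: ratio of `η` to the minimum job workload. -/
def Instance.beta (ω : Instance) : ℝ := ω.eta / ω.minWorkload

/-- A schedule on `N` machines: `σ m t` is the task that machine `m` is processing at time `t`
(`none` if the machine is idle); tasks are named by job number and task number. -/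
abbrev Schedule (N : ℕ) : Type := Fin N → ℝ → Option (ℕ × ℕ)

/-- The task `τ` is being processed at time `t`. -/
def Schedule.Runs {N : ℕ} (σ : Schedule N) (τ : ℕ × ℕ) (t : ℝ) : Prop :=
  ∃ m, σ m t = some τ

/-- The amount of processing that task `τ` has received before time `t`. -/
def Schedule.work {N : ℕ} (σ : Schedule N) (τ : ℕ × ℕ) (t : ℝ) : ℝ :=
  volume.real {s | 0 ≤ s ∧ s < t ∧ σ.Runs τ s}

/-- The schedules that are admissible for an instance. Different tasks of one job may be processed
in parallel; a preemptive task may be interrupted and resumed, on any machine. -/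
structure Feasible {N : ℕ} (ω : Instance) (σ : Schedule N) : Prop where
  measurable : ∀ m τ, MeasurableSet {t | σ m t = some τ}
  /-- Only tasks of released jobs are processed. -/
  released : ∀ m τ t, σ m t = some τ → ∃ J T, ω.HasTask τ J T ∧ J.release ≤ t
  /-- A task is on at most one machine at a time. -/
  sequential : ∀ m m' τ t, σ m t = some τ → σ m' t = some τ → m = m'
  /-- A completed task occupies no machine. -/
  unfinished : ∀ m τ t J T, ω.HasTask τ J T → σ m t = some τ → σ.work τ t < T.size
  /-- Every task is completed eventually. -/
  complete : ∀ τ J T, ω.HasTask τ J T → ∃ t, σ.work τ t = T.size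
  /-- Once started, a non-preemptive task is run to completion on its machine. -/
  nonpreemptive : ∀ τ J T, ω.HasTask τ J T → T.preemptive = false →
    ∃ m s, ∀ m' t, σ m' t = some τ ↔ m' = m ∧ s ≤ t ∧ t < s + T.size

/-- The completion time of task `ℓ` of job `i`. -/
def taskCompletion {N : ℕ} (ω : Instance) (σ : Schedule N) (i : Fin ω.jobs.length)
    (ℓ : Fin ω.jobs[i].tasks.length) : ℝ :=
  sInf {t | σ.work (i, ℓ) t = ω.jobs[i].tasks[ℓ].size}

/-- The completion time of a job is the maximum of the completion times of its tasks. -/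
def jobCompletion {N : ℕ} (ω : Instance) (σ : Schedule N) (i : Fin ω.jobs.length) : ℝ :=
  ⨆ ℓ : Fin ω.jobs[i].tasks.length, taskCompletion ω σ i ℓ

/-- The cost of a schedule: the total response time. -/
def totalResponse {N : ℕ} (ω : Instance) (σ : Schedule N) : ℝ :=
  ∑ i : Fin ω.jobs.length, (jobCompletion ω σ i - ω.jobs[i].release)

/-- The optimal offline cost on `N` machines. -/
def optCost (N : ℕ) (ω : Instance) : ℝ :=
  sInf {x | ∃ σ : Schedule N, Feasible ω σ ∧ x = totalResponse ω σ}

/-- Two instances have the same jobs released up to (and including) time `t`. -/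
def AgreeUpTo (ω ω' : Instance) (t : ℝ) : Prop :=
  ∀ (i : ℕ) (J : Job), J.release ≤ t → (ω.jobs[i]? = some J ↔ ω'.jobs[i]? = some J)

/-- A deterministic online algorithm on `N` machines: it produces an admissible schedule for every
instance, and what it does up to time `t` depends only on the jobs released up to time `t`. -/
structure OnlineAlgorithm (N : ℕ) where
  schedule : Instance → Schedule N
  feasible : ∀ ω, Feasible ω (schedule ω)
  causal : ∀ ω ω' t, AgreeUpTo ω ω' t → ∀ m, ∀ s ≤ t, schedule ω m s = schedule ω' m s

/-- A schedule is work-conserving if, whenever some machine is idle, no released and unfinished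
task is left waiting. -/
def WorkConservingSchedule {N : ℕ} (ω : Instance) (σ : Schedule N) : Prop :=
  ∀ t, (∃ m, σ m t = none) →
    ∀ τ J T, ω.HasTask τ J T → J.release ≤ t → σ.work τ t < T.size → σ.Runs τ t

/-- An algorithm is work-conserving if all its schedules are. -/
def OnlineAlgorithm.WorkConserving {N : ℕ} (A : OnlineAlgorithm N) : Prop :=
  ∀ ω, WorkConservingSchedule ω (A.schedule ω)

/-- The competitive ratio of an algorithm, as a function of the parameters `α` and `β`: the worst
ratio of its cost to the optimal offline cost, over all instances with these parameters. -/
def OnlineAlgorithm.competitiveRatio {N : ℕ} (A : OnlineAlgorithm N) (α β : ℝ) : EReal :=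
  ⨆ (ω : Instance) (_ : ω.alpha = α ∧ ω.beta = β),
    ((totalResponse ω (A.schedule ω) / optCost N ω : ℝ) : EReal)

end MPMS

end

/-! Once there is a backlog of small tasks, a stream of `N` unit jobs per unit of time keeps it
alive: `N` machines do at most `N` units of work per unit of time, so the backlog cannot shrink. If
it always amounts to `B` pending jobs, the algorithm pays `B` per unit of time. An offline plan that
has postponed at most `N` long jobs pays `N` for the stream and at most `N` for the waiting jobs. A
long enough stream therefore forces the ratio `B / (6 * N)` (`OnlineAlgorithm.endgame`); one closing
job after the stream makes the parameters exactly `α` and `β`.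

Two constructions supply the backlog. For `β` (`beta_bound`), `N` non-preemptive jobs of size `β` at
time 0 trap a work-conserving algorithm while about `N * β` unit jobs arrive.

For `ln α` (`phases_bound`, valid for every online algorithm), phases of lengths `2 * q j`, with `q
j` shrinking by the factor 8, each release `N * q j` unit jobs and `N / 2` long jobs of size `2 * q
j`. If many unit jobs remain halfway through some phase, the stream starts there; the offline plan
has done exactly the unit jobs. Otherwise the long jobs were neglected, and since each runs on one
machine at a time, work of order `N * q j` is left at the end of the phase (`backlog_phase`). Later
phases, being geometrically shorter, cannot absorb it (`backlog_phases`). Backlogs at geometrically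
separated size scales must come from essentially different jobs (`sum_backlog_div_le`), so the
number of phases, of order `ln α`, multiplies the count of pending jobs. Small parameters are
covered by the trivial bound 1. -/

noncomputable section

namespace MPMS

/-! ### Work received by tasks and machine capacity -/

namespace Schedule

variable {N : ℕ}

theorem work_nonneg (σ : Schedule N) (τ : ℕ × ℕ) (t : ℝ) : 0 ≤ σ.work τ t :=
  measureReal_nonneg

theorem work_eq_measureReal_Ico (σ : Schedule N) (τ : ℕ × ℕ) (t : ℝ) :
    σ.work τ t = volume.real (Set.Ico 0 t ∩ {s | σ.Runs τ s}) := by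
  unfold work
  congr 1
  ext s
  simp [and_assoc]

theorem setOf_runs (σ : Schedule N) (τ : ℕ × ℕ) :
    {s | σ.Runs τ s} = ⋃ m, {s | σ m s = some τ} := by
  ext s
  simp [Runs]

theorem measureReal_Ico_inter_ne_top (a b : ℝ) (s : Set ℝ) : volume (Set.Ico a b ∩ s) ≠ ⊤ :=
  ne_top_of_le_ne_top (by simp) (measure_mono Set.inter_subset_left)

theorem work_mono (σ : Schedule N) (τ : ℕ × ℕ) : Monotone (σ.work τ) := by
  intro t t' h
  rw [work_eq_measureReal_Ico, work_eq_measureReal_Ico]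
  exact measureReal_mono
    (Set.inter_subset_inter_left _ (Set.Ico_subset_Ico_right h))
    (measureReal_Ico_inter_ne_top _ _ _)

theorem work_sub_work (σ : Schedule N) (τ : ℕ × ℕ) {t t' : ℝ} (ht : 0 ≤ t) (h : t ≤ t') :
    σ.work τ t' - σ.work τ t = volume.real (Set.Ico t t' ∩ {s | σ.Runs τ s}) := by
  have h1 := measureReal_inter_add_sdiff (μ := volume) (s := Set.Ico 0 t' ∩ {s | σ.Runs τ s})
    (t := Set.Iio t) measurableSet_Iio (measureReal_Ico_inter_ne_top _ _ _)
  have h2 : Set.Ico 0 t' ∩ {s | σ.Runs τ s} ∩ Set.Iio t = Set.Ico 0 t ∩ {s | σ.Runs τ s} := by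
    ext s
    simp only [Set.mem_inter_iff, Set.mem_Ico, Set.mem_ofPred_eq, Set.mem_Iio]
    constructor
    · rintro ⟨⟨⟨a, b⟩, c⟩, d⟩
      exact ⟨⟨a, d⟩, c⟩
    · rintro ⟨⟨a, b⟩, c⟩
      exact ⟨⟨⟨a, b.trans_le h⟩, c⟩, b⟩
  have h3 : (Set.Ico 0 t' ∩ {s | σ.Runs τ s}) \ Set.Iio t = Set.Ico t t' ∩ {s | σ.Runs τ s} := by
    ext s
    simp only [Set.mem_inter_iff, Set.mem_Ico, Set.mem_ofPred_eq, Set.mem_Iio, Set.mem_sdiff, not_lt]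
    constructor
    · rintro ⟨⟨⟨a, b⟩, c⟩, d⟩
      exact ⟨⟨d, b⟩, c⟩
    · rintro ⟨⟨a, b⟩, c⟩
      exact ⟨⟨⟨ht.trans a, b⟩, c⟩, a⟩
  rw [h2, h3] at h1
  rw [work_eq_measureReal_Ico, work_eq_measureReal_Ico]
  linarith

theorem work_sub_work_le (σ : Schedule N) (τ : ℕ × ℕ) {t t' : ℝ} (ht : 0 ≤ t) (h : t ≤ t') :
    σ.work τ t' - σ.work τ t ≤ t' - t := by
  rw [work_sub_work σ τ ht h]
  calc _ ≤ volume.real (Set.Ico t t') := measureReal_mono Set.inter_subset_left (by simp)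
    _ = t' - t := by simp [h]

theorem work_eq_zero (σ : Schedule N) (τ : ℕ × ℕ) {t : ℝ}
    (h : ∀ s, 0 ≤ s → s < t → ¬ σ.Runs τ s) : σ.work τ t = 0 := by
  have : {s | 0 ≤ s ∧ s < t ∧ σ.Runs τ s} = ∅ := by
    ext s
    simp only [Set.mem_ofPred_eq, Set.mem_empty_iff_false, iff_false]
    rintro ⟨a, b, c⟩
    exact h s a b c
  simp [work, this]

theorem work_congr {σ σ' : Schedule N} (τ : ℕ × ℕ) {t : ℝ}
    (h : ∀ m s, s < t → σ m s = σ' m s) : σ.work τ t = σ'.work τ t := by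
  unfold work
  congr 1
  ext s
  simp only [Set.mem_ofPred_eq, Runs]
  constructor
  · rintro ⟨a, b, m, hm⟩
    exact ⟨a, b, m, by rw [← h m s b, hm]⟩
  · rintro ⟨a, b, m, hm⟩
    exact ⟨a, b, m, by rw [h m s b, hm]⟩

/-- `N` machines perform at most `N` units of work per unit of time. -/
theorem sum_work_sub_work_le (σ : Schedule N)
    (hσ : ∀ m τ, MeasurableSet {t | σ m t = some τ}) (S : Finset (ℕ × ℕ)) {t t' : ℝ}
    (ht : 0 ≤ t) (h : t ≤ t') :
    ∑ τ ∈ S, (σ.work τ t' - σ.work τ t) ≤ N * (t' - t) := by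
  calc ∑ τ ∈ S, (σ.work τ t' - σ.work τ t)
      ≤ ∑ τ ∈ S, ∑ m, volume.real (Set.Ico t t' ∩ {s | σ m s = some τ}) := by
        refine Finset.sum_le_sum fun τ _ => ?_
        rw [work_sub_work σ τ ht h, setOf_runs, Set.inter_iUnion]
        exact measureReal_iUnion_fintype_le _
    _ = ∑ m, ∑ τ ∈ S, volume.real (Set.Ico t t' ∩ {s | σ m s = some τ}) := Finset.sum_comm
    _ ≤ ∑ _m : Fin N, (t' - t) := by
        refine Finset.sum_le_sum fun m _ => ?_
        rw [← measureReal_biUnion_finset (μ := volume) (h := ?_)]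
        · calc _ ≤ volume.real (Set.Ico t t') := measureReal_mono (by simp) (by simp)
            _ = t' - t := by simp [h]
        · intro τ _ τ' _ hne
          refine Set.disjoint_left.2 ?_
          rintro s ⟨_, h1⟩ ⟨_, h2⟩
          simp only [Set.mem_ofPred_eq] at h1 h2
          exact hne (Option.some.inj (h1.symm.trans h2))
        · exact fun τ _ => measurableSet_Ico.inter (hσ m τ)
        · exact fun τ _ => measureReal_Ico_inter_ne_top _ _ _
    _ = N * (t' - t) := by rw [Finset.sum_const, Finset.card_univ, Fintype.card_fin, nsmul_eq_mul]

end Schedule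

/-! ### First tasks as lower bounds for completion times and costs -/

/-- The processing time of the first task of a job. -/
def Job.headSize (J : Job) : ℝ := (J.tasks.head J.tasks_ne_nil).size

theorem Job.headSize_pos (J : Job) : 0 < J.headSize := Task.size_pos _

namespace Feasible

variable {N : ℕ} {ω : Instance} {σ : Schedule N}

/-- After a time at which the work equals the size, `unfinished` forbids the task to run, so the
work stays constant. -/
theorem work_le_size (hσ : Feasible ω σ) {τ : ℕ × ℕ} {J : Job} {T : Task}
    (h : ω.HasTask τ J T) (t : ℝ) : σ.work τ t ≤ T.size := by
  obtain ⟨t₁, h₁⟩ := hσ.complete τ J T h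
  by_contra! hlt
  have htt : t₁ < t := by
    by_contra! hle
    exact absurd (σ.work_mono τ hle) (by rw [h₁]; exact not_le.2 hlt)
  have h0 : 0 ≤ t₁ := by
    by_contra! hneg
    have : σ.work τ t₁ = 0 := σ.work_eq_zero τ fun s h1 h2 => absurd (h1.trans_lt h2) (by linarith)
    linarith [T.size_pos]
  have hs := σ.work_sub_work τ h0 htt.le
  have hempty : Set.Ico t₁ t ∩ {s | σ.Runs τ s} = ∅ := by
    ext s
    simp only [Set.mem_inter_iff, Set.mem_Ico, Set.mem_ofPred_eq, Set.mem_empty_iff_false, iff_false]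
    rintro ⟨⟨a, _⟩, m, hm⟩
    have := hσ.unfinished m τ s J T h hm
    have := σ.work_mono τ a
    linarith
  rw [hempty] at hs
  simp at hs
  linarith

theorem work_eq_zero_of_le_release (hσ : Feasible ω σ) {τ : ℕ × ℕ} {J : Job}
    (hJ : ω.jobs[τ.1]? = some J) {t : ℝ} (ht : t ≤ J.release) : σ.work τ t = 0 := by
  refine σ.work_eq_zero τ fun s _ hs => ?_
  rintro ⟨m, hm⟩
  obtain ⟨J', T, h1, h2⟩ := hσ.released m τ s hm
  have : J = J' := Option.some.inj (hJ.symm.trans h1.1)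
  subst this
  linarith

theorem hasTask_head (ω : Instance) (i : Fin ω.jobs.length) :
    ω.HasTask (i, 0) ω.jobs[i] (ω.jobs[i].tasks.head ω.jobs[i].tasks_ne_nil) := by
  refine ⟨by simp, ?_⟩
  rw [← List.head?_eq_getElem?, List.head?_eq_some_head]

theorem work_head_le (hσ : Feasible ω σ) (i : Fin ω.jobs.length) (t : ℝ) :
    σ.work (i, 0) t ≤ ω.jobs[i].headSize :=
  hσ.work_le_size (hasTask_head ω i) t

theorem work_head_eq_zero (hσ : Feasible ω σ) (i : Fin ω.jobs.length) {t : ℝ}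
    (ht : t ≤ ω.jobs[i].release) : σ.work (i, 0) t = 0 :=
  hσ.work_eq_zero_of_le_release (hasTask_head ω i).1 ht

theorem le_jobCompletion (hσ : Feasible ω σ) (i : Fin ω.jobs.length) {t : ℝ}
    (h : ∀ t', σ.work (i, 0) t' = ω.jobs[i].headSize → t ≤ t') :
    t ≤ jobCompletion ω σ i := by
  have hpos : 0 < ω.jobs[i].tasks.length := List.length_pos_iff.2 ω.jobs[i].tasks_ne_nil
  have h1 : taskCompletion ω σ i ⟨0, hpos⟩ ≤ jobCompletion ω σ i :=
    le_ciSup (f := fun ℓ => taskCompletion ω σ i ℓ) (Set.finite_range _).bddAbove ⟨0, hpos⟩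
  refine le_trans ?_ h1
  have h2 : ω.jobs[i].tasks[(⟨0, hpos⟩ : Fin ω.jobs[i].tasks.length)].size
      = ω.jobs[i].headSize := by
    unfold Job.headSize
    congr 1
    exact (List.head_eq_getElem _).symm
  unfold taskCompletion
  refine le_csInf ?_ fun t' ht' => h t' ?_
  · obtain ⟨t₀, h₀⟩ := hσ.complete _ _ _ (hasTask_head ω i)
    exact ⟨t₀, by rw [Set.mem_ofPred_eq, h2]; exact h₀⟩
  · rw [Set.mem_ofPred_eq, h2] at ht'
    exact ht'

theorem release_add_headSize_le (hσ : Feasible ω σ) (i : Fin ω.jobs.length) :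
    ω.jobs[i].release + ω.jobs[i].headSize ≤ jobCompletion ω σ i := by
  refine hσ.le_jobCompletion i fun t' ht' => ?_
  have hp := ω.jobs[i].headSize_pos
  have h0 := hσ.work_head_eq_zero i le_rfl
  by_contra! hlt
  rcases le_total t' ω.jobs[i].release with h | h
  · have := hσ.work_head_eq_zero i h
    linarith
  · have := σ.work_sub_work_le (i, 0) ω.jobs[i].release_nonneg h
    linarith

theorem sum_headSize_le (hσ : Feasible ω σ) :
    ∑ i : Fin ω.jobs.length, ω.jobs[i].headSize ≤ totalResponse ω σ :=
  Finset.sum_le_sum fun i _ => by linarith [hσ.release_add_headSize_le i]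

/-- The infimum is a genuine one because every feasible cost is at least the sum of the first task
sizes. -/
theorem optCost_le (hσ : Feasible ω σ) : optCost N ω ≤ totalResponse ω σ := by
  refine csInf_le ⟨∑ i : Fin ω.jobs.length, ω.jobs[i].headSize, ?_⟩ ⟨σ, hσ, rfl⟩
  rintro x ⟨σ', h', rfl⟩
  exact h'.sum_headSize_le

/-- Keeps the quotient in `competitiveRatio` away from the default value of division by zero. -/
theorem optCost_pos (hσ : Feasible ω σ) : 0 < optCost N ω := by
  have h1 : ∑ i : Fin ω.jobs.length, ω.jobs[i].headSize ≤ optCost N ω := by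
    refine le_csInf ⟨_, σ, hσ, rfl⟩ ?_
    rintro x ⟨σ', h', rfl⟩
    exact h'.sum_headSize_le
  refine lt_of_lt_of_le ?_ h1
  have : Nonempty (Fin ω.jobs.length) := ⟨⟨0, List.length_pos_iff.2 ω.jobs_ne_nil⟩⟩
  exact Finset.sum_pos (fun i _ => Job.headSize_pos _) Finset.univ_nonempty

end Feasible

/-! ### Arrivals, backlog and pending jobs -/

open Classical in
/-- The total processing time of the first tasks, with sizes in `C`, of the jobs of `l` that are
released before time `t`. -/
def arrived (l : List Job) (C : Set ℝ) (t : ℝ) : ℝ :=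
  (l.map fun J => if J.release < t ∧ J.headSize ∈ C then J.headSize else 0).sum

open Classical in
/-- The number of the jobs of `l` released before time `t` whose first task has its size in `C`. -/
def arrivedCount (l : List Job) (C : Set ℝ) (t : ℝ) : ℝ :=
  (l.map fun J => if J.release < t ∧ J.headSize ∈ C then 1 else 0).sum

open Classical in
/-- The unprocessed amount at time `t` of the first tasks with sizes in `C` released before `t`. -/
def backlog {N : ℕ} (ω : Instance) (σ : Schedule N) (C : Set ℝ) (t : ℝ) : ℝ :=
  ∑ i : Fin ω.jobs.length, if ω.jobs[i].release < t ∧ ω.jobs[i].headSize ∈ C then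
    ω.jobs[i].headSize - σ.work (i, 0) t else 0

open Classical in
/-- The number of jobs released before `t` whose first task is unfinished at time `t`. -/
def pending {N : ℕ} (ω : Instance) (σ : Schedule N) (t : ℝ) : ℝ :=
  ∑ i : Fin ω.jobs.length, if ω.jobs[i].release < t ∧ σ.work (i, 0) t < ω.jobs[i].headSize then
    1 else 0

variable {N : ℕ} {ω : Instance} {σ : Schedule N}

namespace Feasible

open Classical in
theorem backlog_eq (hσ : Feasible ω σ) (C : Set ℝ) (t : ℝ) :
    backlog ω σ C t = arrived ω.jobs C t -
      ∑ i : Fin ω.jobs.length with ω.jobs[i].headSize ∈ C, σ.work (i, 0) t := by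
  unfold backlog arrived
  rw [← Fin.sum_univ_fun_getElem, Finset.sum_filter, ← Finset.sum_sub_distrib]
  refine Finset.sum_congr rfl fun i _ => ?_
  by_cases hC : ω.jobs[i].headSize ∈ C
  · by_cases hr : ω.jobs[i].release < t
    · have h1 : ω.jobs[i.1].release < t := hr
      have h2 : ω.jobs[i.1].headSize ∈ C := hC
      simp [h1, h2]
    · have h1 : ¬ ω.jobs[i.1].release < t := hr
      have h2 := hσ.work_head_eq_zero i (not_lt.1 hr)
      simp [h1, h2]
  · have h2 : ω.jobs[i.1].headSize ∉ C := hC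
    simp [h2]

theorem backlog_nonneg (hσ : Feasible ω σ) (C : Set ℝ) (t : ℝ) : 0 ≤ backlog ω σ C t := by
  refine Finset.sum_nonneg fun i _ => ?_
  split_ifs
  · linarith [hσ.work_head_le i t]
  · rfl

theorem backlog_mono (hσ : Feasible ω σ) {C D : Set ℝ} (h : C ⊆ D) (t : ℝ) :
    backlog ω σ C t ≤ backlog ω σ D t := by
  refine Finset.sum_le_sum fun i _ => ?_
  split_ifs with h1 h2 h2
  · rfl
  · exact absurd ⟨h1.1, h h1.2⟩ h2
  · linarith [hσ.work_head_le i t]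
  · rfl

theorem backlog_union {C D : Set ℝ} (h : Disjoint C D) (t : ℝ) :
    backlog ω σ (C ∪ D) t = backlog ω σ C t + backlog ω σ D t := by
  unfold backlog
  rw [← Finset.sum_add_distrib]
  refine Finset.sum_congr rfl fun i _ => ?_
  have hd : ω.jobs[i].headSize ∈ C → ω.jobs[i].headSize ∉ D := fun a b => Set.disjoint_left.1 h a b
  by_cases h1 : ω.jobs[i].release < t <;> by_cases h2 : ω.jobs[i].headSize ∈ C <;>
    by_cases h3 : ω.jobs[i].headSize ∈ D <;> simp only [Set.mem_union, h1, h2, h3] <;> simp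
  exact absurd h3 (hd h2)

/-- Uses the total capacity of the `N` machines; its counterpart `backlog_ge_sub_count` uses that a
single task progresses at speed at most 1. -/
theorem backlog_ge (hσ : Feasible ω σ) (C : Set ℝ) {t t' : ℝ} (ht : 0 ≤ t) (h : t ≤ t') :
    backlog ω σ C t + (arrived ω.jobs C t' - arrived ω.jobs C t) - N * (t' - t)
      ≤ backlog ω σ C t' := by
  classical
  rw [hσ.backlog_eq, hσ.backlog_eq]
  set S : Finset (Fin ω.jobs.length) := {i | ω.jobs[i].headSize ∈ C} with hS
  have h1 := σ.sum_work_sub_work_le hσ.measurable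
    (S.map ⟨fun i : Fin ω.jobs.length => ((i : ℕ), 0), fun i j hij => Fin.ext (congrArg Prod.fst hij)⟩) ht h
  rw [Finset.sum_map, Finset.sum_sub_distrib] at h1
  change ∑ i ∈ S, σ.work ((i : ℕ), 0) t' - ∑ i ∈ S, σ.work ((i : ℕ), 0) t ≤ _ at h1
  linarith

theorem backlog_ge_sub_count (hσ : Feasible ω σ) (C : Set ℝ) {t t' : ℝ} (ht : 0 ≤ t)
    (h : t ≤ t') :
    backlog ω σ C t - arrivedCount ω.jobs C t' * (t' - t) ≤ backlog ω σ C t' := by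
  unfold arrivedCount backlog
  rw [← Fin.sum_univ_fun_getElem, Finset.sum_mul, ← Finset.sum_sub_distrib]
  refine Finset.sum_le_sum fun i _ => ?_
  have h1 := σ.work_sub_work_le (i, 0) ht h
  have h2 := hσ.work_head_le i t'
  simp only [Fin.getElem_fin] at *
  by_cases hC : ω.jobs[i.1].headSize ∈ C
  · by_cases hr : ω.jobs[i.1].release < t
    · simp only [hr, hr.trans_le h, hC, and_self, if_true]
      linarith
    · by_cases hr' : ω.jobs[i.1].release < t'
      · simp only [hr, hr', hC, and_self, false_and, if_true, if_false]
        linarith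
      · simp [hr, hr']
  · simp [hC]

theorem backlog_le_pending (hσ : Feasible ω σ) (t : ℝ) :
    backlog ω σ (Set.Iic 1) t ≤ pending ω σ t := by
  refine Finset.sum_le_sum fun i _ => ?_
  have h0 := σ.work_nonneg (i, 0) t
  have h1 := hσ.work_head_le i t
  split_ifs with h2 h3 h3
  · have := h2.2
    simp only [Set.mem_Iic] at this
    linarith
  · have : ¬ σ.work (i, 0) t < ω.jobs[i].headSize := fun h => h3 ⟨h2.1, h⟩
    linarith
  · norm_num
  · rfl

/-- Backlogs with respect to sparse size thresholds `θ i` force many pending jobs. -/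
theorem sum_backlog_div_le (hσ : Feasible ω σ) {k : ℕ} {θ : ℕ → ℝ} (hθ : ∀ i < k, 0 < θ i)
    (hsum : ∀ s : ℝ, 0 < s → ∑ i ∈ Finset.range k, (if s ≤ θ i then 1 / θ i else 0) ≤ 2 / s)
    (t : ℝ) :
    ∑ i ∈ Finset.range k, backlog ω σ (Set.Iic (θ i)) t / θ i ≤ 2 * pending ω σ t := by
  unfold backlog pending
  simp_rw [Finset.sum_div]
  rw [Finset.sum_comm, Finset.mul_sum]
  refine Finset.sum_le_sum fun j _ => ?_
  have h0 := σ.work_nonneg (j, 0) t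
  have h1 := hσ.work_head_le j t
  have hp := ω.jobs[j].headSize_pos
  simp only [Fin.getElem_fin] at *
  by_cases hr : ω.jobs[j.1].release < t
  · by_cases hw : σ.work (j, 0) t < ω.jobs[j.1].headSize
    · simp only [hr, hw, and_self, if_true, true_and, Set.mem_Iic]
      -- A job of size `s` enters only the sums with `s ≤ θ i`, each time with at most `s / θ i`; by
      -- `hsum` it contributes at most 2 in total.
      calc _ = (ω.jobs[j.1].headSize - σ.work (j, 0) t) *
            ∑ i ∈ Finset.range k, (if ω.jobs[j.1].headSize ≤ θ i then 1 / θ i else 0) := by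
            rw [Finset.mul_sum]
            refine Finset.sum_congr rfl fun i _ => ?_
            split_ifs <;> ring
        _ ≤ ω.jobs[j.1].headSize * (2 / ω.jobs[j.1].headSize) := by
            refine mul_le_mul (by linarith) (hsum _ hp) ?_ hp.le
            refine Finset.sum_nonneg fun i hi => ?_
            have := hθ i (Finset.mem_range.1 hi)
            split_ifs <;> positivity
        _ = 2 * 1 := by field_simp
    · have : ω.jobs[j.1].headSize - σ.work (j, 0) t = 0 := by linarith
      simp [this, hw]
  · simp [hr]

/-- A job with integer release date `r` is pending only at integers `t` with `r < t ≤ C`, of which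
there are at most `C - r`. -/
theorem sum_pending_le (hσ : Feasible ω σ) (hr : ∀ J ∈ ω.jobs, ∃ n : ℕ, J.release = n) (a b : ℕ) :
    ∑ t ∈ Finset.Ioc a b, pending ω σ t ≤ totalResponse ω σ := by
  unfold pending totalResponse
  rw [Finset.sum_comm]
  refine Finset.sum_le_sum fun i _ => ?_
  obtain ⟨r, hr⟩ := hr ω.jobs[i] (List.getElem_mem _)
  have hC : (0:ℝ) ≤ jobCompletion ω σ i := by
    have := hσ.release_add_headSize_le i
    have := ω.jobs[i].headSize_pos
    have := ω.jobs[i].release_nonneg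
    linarith
  have hrC : (r:ℝ) ≤ jobCompletion ω σ i := by
    have := hσ.release_add_headSize_le i
    have := ω.jobs[i].headSize_pos
    linarith
  rw [Finset.sum_boole, hr]
  have hsub : (Finset.Ioc a b).filter (fun t : ℕ => (r : ℝ) < t ∧
      σ.work (i, 0) t < ω.jobs[i].headSize) ⊆ Finset.Ioc r ⌊jobCompletion ω σ i⌋₊ := by
    intro t ht
    rw [Finset.mem_filter] at ht
    rw [Finset.mem_Ioc]
    refine ⟨by exact_mod_cast ht.2.1, Nat.le_floor ?_⟩
    refine hσ.le_jobCompletion i fun t' ht' => ?_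
    by_contra! hlt
    have := σ.work_mono (i, 0) hlt.le
    linarith [ht.2.2]
  have h1 := Finset.card_le_card hsub
  rw [Nat.card_Ioc] at h1
  have h2 : r ≤ ⌊jobCompletion ω σ i⌋₊ := Nat.le_floor hrC
  calc _ ≤ ((⌊jobCompletion ω σ i⌋₊ - r : ℕ) : ℝ) := by exact_mod_cast h1
    _ = ⌊jobCompletion ω σ i⌋₊ - r := by push_cast [h2]; ring
    _ ≤ _ := by linarith [Nat.floor_le hC]

end Feasible

/-- The jobs of a sublist that are released in `[t, t')` contribute to the arrivals. -/
theorem arrived_sub_arrived_ge (X Y Z : List Job) (C : Set ℝ) {t t' : ℝ} (h : t ≤ t')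
    (hY : ∀ J ∈ Y, t ≤ J.release ∧ J.release < t' ∧ J.headSize ∈ C) :
    (Y.map Job.headSize).sum ≤ arrived (X ++ Y ++ Z) C t' - arrived (X ++ Y ++ Z) C t := by
  have hmono : ∀ l : List Job, arrived l C t ≤ arrived l C t' := by
    intro l
    refine List.sum_le_sum fun J _ => ?_
    have := J.headSize_pos
    split_ifs with h1 h2 h2
    · rfl
    · exact absurd ⟨h1.1.trans_le h, h1.2⟩ h2
    · exact this.le
    · rfl
  have h1 : arrived Y C t = 0 := by
    refine List.sum_eq_zero ?_
    intro x hx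
    obtain ⟨J, hJ, rfl⟩ := List.mem_map.1 hx
    have := (hY J hJ).1
    simp [not_lt.2 this]
  have h2 : arrived Y C t' = (Y.map Job.headSize).sum := by
    unfold arrived
    congr 1
    refine List.map_congr_left fun J hJ => ?_
    have := hY J hJ
    simp [this.2]
  have happ : ∀ (l l' : List Job) s, arrived (l ++ l') C s = arrived l C s + arrived l' C s := by
    intro l l' s
    simp [arrived]
  rw [happ, happ, happ, happ, h1, h2]
  linarith [hmono X, hmono Z]

/-! ### Causality: the adversary may adapt to the algorithm -/

theorem AgreeUpTo.of_append {ω ω' : Instance} {X Y Y' : List Job} (h : ω.jobs = X ++ Y)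
    (h' : ω'.jobs = X ++ Y') {t : ℝ} (hY : ∀ J ∈ Y, t < J.release)
    (hY' : ∀ J ∈ Y', t < J.release) : AgreeUpTo ω ω' t := by
  intro i J hJ
  rw [h, h', List.getElem?_append, List.getElem?_append]
  split_ifs with hi
  · rfl
  · constructor
    · intro hm
      exact absurd (hY J (List.mem_of_getElem? hm)) (not_lt.2 hJ)
    · intro hm
      exact absurd (hY' J (List.mem_of_getElem? hm)) (not_lt.2 hJ)

/-- Backlogs before the first difference of two instances agree. -/
theorem OnlineAlgorithm.backlog_eq_of_append (A : OnlineAlgorithm N) {ω ω' : Instance}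
    {X Y Y' : List Job} (h : ω.jobs = X ++ Y) (h' : ω'.jobs = X ++ Y') {t : ℝ}
    (hY : ∀ J ∈ Y, t ≤ J.release) (hY' : ∀ J ∈ Y', t ≤ J.release) (C : Set ℝ) :
    backlog ω (A.schedule ω) C t = backlog ω' (A.schedule ω') C t := by
  classical
  have hw : ∀ τ, (A.schedule ω).work τ t = (A.schedule ω').work τ t := by
    intro τ
    -- Work before `t` involves only times `s < t`, so jobs released exactly at `t` may already
    -- differ.
    refine Schedule.work_congr τ fun m s hs => ?_
    exact A.causal ω ω' s (AgreeUpTo.of_append h h' (fun J hJ => hs.trans_le (hY J hJ))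
      (fun J hJ => hs.trans_le (hY' J hJ))) m s le_rfl
  have key : ∀ (ω₁ : Instance) (Y₁ : List Job), ω₁.jobs = X ++ Y₁ →
      (∀ J ∈ Y₁, t ≤ J.release) → ∀ σ : Schedule N,
      backlog ω₁ σ C t = ∑ i : Fin X.length, if X[i].release < t ∧ X[i].headSize ∈ C then
        X[i].headSize - σ.work (i, 0) t else 0 := by
    intro ω₁ Y₁ h₁ hY₁ σ
    unfold backlog
    have e1 : ∀ (l l' : List Job), l = l' →
        (∑ i : Fin l.length, if l[i].release < t ∧ l[i].headSize ∈ C then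
        l[i].headSize - σ.work (i, 0) t else 0) =
        ∑ i : Fin l'.length, if l'[i].release < t ∧ l'[i].headSize ∈ C then
        l'[i].headSize - σ.work (i, 0) t else 0 := by
      rintro l _ rfl
      rfl
    rw [e1 _ _ h₁]
    rw [← (finCongr (List.length_append (as := X) (bs := Y₁))).symm.sum_comp, Fin.sum_univ_add]
    rw [Finset.sum_eq_zero (s := (Finset.univ : Finset (Fin Y₁.length))), add_zero]
    · refine Finset.sum_congr rfl fun i _ => ?_
      simp
    · intro i _
      have : t ≤ Y₁[i].release := hY₁ _ (List.getElem_mem _)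
      simp only [Fin.getElem_fin] at this
      simp [not_lt.2 this]
  rw [key ω Y h hY, key ω' Y' h' hY']
  simp_rw [hw]

/-! ### Offline plans as feasible schedules -/

/-- A job together with the machine on which, and the time from which, a plan processes its tasks
one after the other without interruption. -/
structure Entry where
  job : Job
  machine : ℕ
  start : ℝ

namespace Entry

def finish (e : Entry) : ℝ := e.start + e.job.workload

/-- The time at which task number `ℓ` is started. -/
def taskStart (e : Entry) (ℓ : ℕ) : ℝ := e.start + ((e.job.tasks.take ℓ).map Task.size).sum

/-- Two entries do not occupy a machine at the same time. -/
def Compatible (e e' : Entry) : Prop :=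
  e.machine ≠ e'.machine ∨ e.finish ≤ e'.start ∨ e'.finish ≤ e.start

theorem Compatible.symm {e e' : Entry} (h : e.Compatible e') : e'.Compatible e := by
  rcases h with h | h | h
  · exact Or.inl h.symm
  · exact Or.inr (Or.inr h)
  · exact Or.inr (Or.inl h)

theorem taskStart_add_size {e : Entry} {ℓ : ℕ} {T : Task} (h : e.job.tasks[ℓ]? = some T) :
    e.taskStart ℓ + T.size = e.taskStart (ℓ + 1) := by
  unfold taskStart
  rw [List.take_add_one, h]
  simp [add_assoc]

theorem taskStart_mono (e : Entry) : Monotone e.taskStart := by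
  refine monotone_nat_of_le_succ fun ℓ => ?_
  rcases h : e.job.tasks[ℓ]? with _ | T
  · unfold taskStart
    rw [List.take_add_one, h]
    simp
  · rw [← taskStart_add_size h]
    linarith [T.size_pos]

theorem start_le_taskStart (e : Entry) (ℓ : ℕ) : e.start ≤ e.taskStart ℓ := by
  simpa [taskStart] using e.taskStart_mono (Nat.zero_le ℓ)

theorem taskStart_add_size_le_finish {e : Entry} {ℓ : ℕ} {T : Task}
    (h : e.job.tasks[ℓ]? = some T) : e.taskStart ℓ + T.size ≤ e.finish := by
  rw [taskStart_add_size h]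
  obtain ⟨hl, -⟩ := List.getElem?_eq_some_iff.1 h
  calc _ ≤ e.taskStart e.job.tasks.length := e.taskStart_mono hl
    _ = e.finish := by simp [taskStart, finish, Job.workload]

end Entry

/-- The plan `l` for `N` machines is consistent and takes place in the time window `[a, b)`. -/
def Fits (N : ℕ) (a b : ℝ) (l : List Entry) : Prop :=
  (∀ e ∈ l, a ≤ e.start ∧ e.job.release ≤ e.start ∧ e.finish ≤ b ∧ e.machine < N) ∧
    l.Pairwise Entry.Compatible

namespace Fits

variable {N : ℕ} {a b c : ℝ} {l l' : List Entry}

theorem append (h : Fits N a b l) (h' : Fits N b c l') (hab : a ≤ b) (hbc : b ≤ c) :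
    Fits N a c (l ++ l') := by
  refine ⟨fun e he => ?_, List.pairwise_append.2 ⟨h.2, h'.2, fun e he e' he' => ?_⟩⟩
  · rcases List.mem_append.1 he with he | he
    · have := h.1 e he
      exact ⟨this.1, this.2.1, this.2.2.1.trans hbc, this.2.2.2⟩
    · have := h'.1 e he
      exact ⟨hab.trans this.1, this.2⟩
  · exact Or.inr (Or.inl ((h.1 e he).2.2.1.trans (h'.1 e' he').1))

theorem perm (h : Fits N a b l) (hl : l.Perm l') : Fits N a b l' :=
  ⟨fun e he => h.1 e (hl.mem_iff.2 he), (hl.pairwise_iff fun h => h.symm).1 h.2⟩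

theorem mono {a' b' : ℝ} (h : Fits N a b l) (ha : a' ≤ a) (hb : b ≤ b') : Fits N a' b' l :=
  ⟨fun e he => ⟨ha.trans (h.1 e he).1, (h.1 e he).2.1, (h.1 e he).2.2.1.trans hb,
    (h.1 e he).2.2.2⟩, h.2⟩

theorem nil : Fits N a b [] := ⟨by simp, List.Pairwise.nil⟩

end Fits

/-- `PlanRuns l τ m t`: the plan `l` processes task `τ` on machine `m` at time `t`. -/
def PlanRuns (l : List Entry) (τ : ℕ × ℕ) (m : ℕ) (t : ℝ) : Prop :=
  ∃ e T, l[τ.1]? = some e ∧ e.job.tasks[τ.2]? = some T ∧ e.machine = m ∧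
    e.taskStart τ.2 ≤ t ∧ t < e.taskStart τ.2 + T.size

/-- Makes the arbitrary choice in `planSchedule` harmless: compatible entries never overlap on a
machine, and the tasks within an entry run consecutively. -/
theorem PlanRuns.unique {N : ℕ} {a b : ℝ} {l : List Entry} (hl : Fits N a b l)
    {τ τ' : ℕ × ℕ} {m : ℕ} {t : ℝ} (h : PlanRuns l τ m t) (h' : PlanRuns l τ' m t) : τ = τ' := by
  obtain ⟨i, ℓ⟩ := τ
  obtain ⟨i', ℓ'⟩ := τ'
  obtain ⟨e, T, he, hT, hm, h1, h2⟩ := h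
  obtain ⟨e', T', he', hT', hm', h1', h2'⟩ := h'
  dsimp only at *
  have hstart := (e.start_le_taskStart ℓ).trans h1
  have hfin := h2.trans_le (Entry.taskStart_add_size_le_finish hT)
  have hstart' := (e'.start_le_taskStart ℓ').trans h1'
  have hfin' := h2'.trans_le (Entry.taskStart_add_size_le_finish hT')
  have hii : i = i' := by
    by_contra hne
    have hc : e.Compatible e' := by
      obtain ⟨hi, rfl⟩ := List.getElem?_eq_some_iff.1 he
      obtain ⟨hi', rfl⟩ := List.getElem?_eq_some_iff.1 he'
      rcases lt_or_gt_of_ne hne with hlt | hlt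
      · exact List.pairwise_iff_getElem.1 hl.2 i i' hi hi' hlt
      · exact (List.pairwise_iff_getElem.1 hl.2 i' i hi' hi hlt).symm
    rcases hc with hc | hc | hc
    · exact hc (hm.trans hm'.symm)
    · linarith
    · linarith
  subst hii
  obtain rfl : e = e' := Option.some.inj (he.symm.trans he')
  rcases lt_trichotomy ℓ ℓ' with h | h | h
  · have := e.taskStart_mono (Nat.succ_le_of_lt h)
    rw [Nat.succ_eq_add_one, ← Entry.taskStart_add_size hT] at this
    linarith
  · rw [h]
  · have := e.taskStart_mono (Nat.succ_le_of_lt h)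
    rw [Nat.succ_eq_add_one, ← Entry.taskStart_add_size hT'] at this
    linarith

open Classical in
/-- The schedule that executes a plan. -/
def planSchedule (N : ℕ) (l : List Entry) : Schedule N := fun m t =>
  if h : ∃ τ, PlanRuns l τ m t then some h.choose else none

section Plan

variable {N : ℕ} {a b : ℝ} {l : List Entry} {ω : Instance}

theorem planSchedule_eq_some_iff (hl : Fits N a b l) (m : Fin N) (t : ℝ) (τ : ℕ × ℕ) :
    planSchedule N l m t = some τ ↔ PlanRuns l τ m t := by
  unfold planSchedule
  split_ifs with h
  · rw [Option.some_inj]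
    constructor
    · rintro rfl
      exact h.choose_spec
    · exact fun h' => h.choose_spec.unique hl h'
  · simp only [false_iff]
    exact fun h' => h ⟨τ, h'⟩

theorem planSchedule_iff (hl : Fits N a b l) {i ℓ : ℕ} {e : Entry} {T : Task}
    (he : l[i]? = some e) (hT : e.job.tasks[ℓ]? = some T) (m : Fin N) (t : ℝ) :
    planSchedule N l m t = some (i, ℓ) ↔
      m = ⟨e.machine, (hl.1 e (List.mem_of_getElem? he)).2.2.2⟩ ∧
      e.taskStart ℓ ≤ t ∧ t < e.taskStart ℓ + T.size := by
  rw [planSchedule_eq_some_iff hl]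
  constructor
  · rintro ⟨e', T', he', hT', hm, h⟩
    obtain rfl : e = e' := Option.some.inj (he.symm.trans he')
    obtain rfl : T = T' := Option.some.inj (hT.symm.trans hT')
    exact ⟨Fin.ext hm.symm, h⟩
  · rintro ⟨rfl, h⟩
    exact ⟨e, T, he, hT, rfl, h⟩

theorem planSchedule_work (hl : Fits N a b l) {i ℓ : ℕ} {e : Entry} {T : Task}
    (he : l[i]? = some e) (hT : e.job.tasks[ℓ]? = some T) {t : ℝ} (h1 : e.taskStart ℓ ≤ t)
    (h2 : t ≤ e.taskStart ℓ + T.size) :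
    (planSchedule N l).work (i, ℓ) t = t - e.taskStart ℓ := by
  have hs : {s | 0 ≤ s ∧ s < t ∧ (planSchedule N l).Runs (i, ℓ) s} = Set.Ico (e.taskStart ℓ) t := by
    ext s
    simp only [Set.mem_ofPred_eq, Schedule.Runs, planSchedule_iff hl he hT, Set.mem_Ico]
    constructor
    · rintro ⟨_, h, m, -, h', -⟩
      exact ⟨h', h⟩
    · rintro ⟨h, h'⟩
      refine ⟨?_, h', _, rfl, h, by linarith⟩
      have := (hl.1 e (List.mem_of_getElem? he)).2.1
      linarith [e.start_le_taskStart ℓ, e.job.release_nonneg]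
  unfold Schedule.work
  rw [hs]
  simp [h1]

theorem hasTask_iff_of_plan (hω : ω.jobs = l.map Entry.job) {τ : ℕ × ℕ} {J : Job} {T : Task} :
    ω.HasTask τ J T ↔ ∃ e, l[τ.1]? = some e ∧ e.job = J ∧ e.job.tasks[τ.2]? = some T := by
  unfold Instance.HasTask
  rw [hω, List.getElem?_map, Option.map_eq_some_iff]
  constructor
  · rintro ⟨⟨e, h1, rfl⟩, h2⟩
    exact ⟨e, h1, rfl, h2⟩
  · rintro ⟨e, h1, rfl, h2⟩
    exact ⟨⟨e, h1, rfl⟩, h2⟩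

/-- Plans never interrupt a task, so preemptive and non-preemptive tasks need no distinction. -/
theorem planSchedule_feasible (hω : ω.jobs = l.map Entry.job) (hl : Fits N a b l) :
    Feasible ω (planSchedule N l) where
  measurable m τ := by
    by_cases h : ∃ e T, l[τ.1]? = some e ∧ e.job.tasks[τ.2]? = some T
    · obtain ⟨e, T, he, hT⟩ := h
      by_cases hm : m = ⟨e.machine, (hl.1 e (List.mem_of_getElem? he)).2.2.2⟩
      · have : {t | planSchedule N l m t = some τ} =
            Set.Ico (e.taskStart τ.2) (e.taskStart τ.2 + T.size) := by
          ext t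
          rw [Set.mem_ofPred_eq, ← Prod.mk.eta (p := τ), planSchedule_iff hl he hT]
          simp [hm]
        rw [this]
        exact measurableSet_Ico
      · have : {t | planSchedule N l m t = some τ} = ∅ := by
          ext t
          rw [Set.mem_ofPred_eq, ← Prod.mk.eta (p := τ), planSchedule_iff hl he hT]
          simp [hm]
        rw [this]
        exact MeasurableSet.empty
    · have : {t | planSchedule N l m t = some τ} = ∅ := by
        ext t
        rw [Set.mem_ofPred_eq, planSchedule_eq_some_iff hl]
        simp only [Set.mem_empty_iff_false, iff_false]
        rintro ⟨e, T, he, hT, -⟩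
        exact h ⟨e, T, he, hT⟩
      rw [this]
      exact MeasurableSet.empty
  released m τ t h := by
    obtain ⟨e, T, he, hT, -, h1, -⟩ := (planSchedule_eq_some_iff hl m t τ).1 h
    exact ⟨e.job, T, (hasTask_iff_of_plan hω).2 ⟨e, he, rfl, hT⟩,
      (hl.1 e (List.mem_of_getElem? he)).2.1.trans ((e.start_le_taskStart _).trans h1)⟩
  sequential m m' τ t h h' := by
    obtain ⟨e, T, he, hT, -⟩ := (planSchedule_eq_some_iff hl m t τ).1 h
    rw [← Prod.mk.eta (p := τ), planSchedule_iff hl he hT] at h h'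
    exact h.1.trans h'.1.symm
  unfinished m τ t J T h hr := by
    obtain ⟨e, he, rfl, hT⟩ := (hasTask_iff_of_plan hω).1 h
    rw [← Prod.mk.eta (p := τ), planSchedule_iff hl he hT] at hr
    rw [← Prod.mk.eta (p := τ), planSchedule_work hl he hT hr.2.1 hr.2.2.le]
    linarith
  complete τ J T h := by
    obtain ⟨e, he, rfl, hT⟩ := (hasTask_iff_of_plan hω).1 h
    refine ⟨e.taskStart τ.2 + T.size, ?_⟩
    rw [← Prod.mk.eta (p := τ), planSchedule_work hl he hT (by linarith [T.size_pos]) le_rfl]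
    ring
  nonpreemptive τ J T h _ := by
    obtain ⟨e, he, rfl, hT⟩ := (hasTask_iff_of_plan hω).1 h
    exact ⟨_, _, fun m t => planSchedule_iff hl he hT m t⟩

theorem getElem?_jobs_of_plan (hω : ω.jobs = l.map Entry.job) {i : ℕ} {e : Entry}
    (he : l[i]? = some e) : ω.jobs[i]? = some e.job := by
  rw [hω, List.getElem?_map, he]
  rfl

theorem planSchedule_jobCompletion_le (hω : ω.jobs = l.map Entry.job) (hl : Fits N a b l)
    (i : Fin ω.jobs.length) {e : Entry} (he : l[i.1]? = some e) :
    jobCompletion ω (planSchedule N l) i ≤ e.finish := by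
  have hJ : ω.jobs[i] = e.job := by
    exact (List.getElem?_eq_some_iff.1 (getElem?_jobs_of_plan hω he)).2
  have : Nonempty (Fin ω.jobs[i].tasks.length) :=
    ⟨⟨0, List.length_pos_iff.2 ω.jobs[i].tasks_ne_nil⟩⟩
  refine ciSup_le fun ℓ => ?_
  have hT : e.job.tasks[ℓ.1]? = some ω.jobs[i].tasks[ℓ] := by
    rw [← hJ]
    simp
  refine le_trans (csInf_le ⟨0, fun t ht => ?_⟩ ?_) (Entry.taskStart_add_size_le_finish hT)
  · by_contra! hneg
    have h0 : (planSchedule N l).work (i, ℓ) t = 0 :=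
      Schedule.work_eq_zero _ _ fun s h1 h2 => absurd (h1.trans_lt h2) (by linarith)
    rw [Set.mem_ofPred_eq, h0] at ht
    linarith [ω.jobs[i].tasks[ℓ].size_pos]
  · rw [Set.mem_ofPred_eq, planSchedule_work hl he hT
      (by linarith [ω.jobs[i].tasks[ℓ].size_pos]) le_rfl]
    ring

/-- The cost of a plan bounds the optimal cost. -/
theorem optCost_le_of_plan (hω : ω.jobs = l.map Entry.job) (hl : Fits N a b l) :
    optCost N ω ≤ (l.map fun e => e.finish - e.job.release).sum := by
  refine (planSchedule_feasible hω hl).optCost_le.trans ?_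
  have hlen : ω.jobs.length = l.length := by rw [hω, List.length_map]
  rw [← Fin.sum_univ_fun_getElem, ← (finCongr hlen).sum_comp]
  refine Finset.sum_le_sum fun i _ => ?_
  have he : l[i.1]? = some l[(finCongr hlen i).1] := by simp
  have h1 := planSchedule_jobCompletion_le hω hl i he
  have hJ : ω.jobs[i].release = l[(finCongr hlen i).1].job.release := by
    congr 1
    exact (List.getElem?_eq_some_iff.1 (getElem?_jobs_of_plan hω he)).2
  linarith

end Plan

/-! ### The adversary's jobs and the instance parameters -/

/-- A job with a single task. -/
def singleJob (r : ℕ) (p : ℝ) (hp : 0 < p) (b : Bool) : Job :=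
  ⟨r, r.cast_nonneg, [⟨p, hp, b⟩], by simp⟩

/-- A preemptive job of unit size. -/
def unitJob (r : ℕ) : Job := singleJob r 1 one_pos true

@[simp] theorem singleJob_release (r : ℕ) (p : ℝ) (hp : 0 < p) (b : Bool) :
    (singleJob r p hp b).release = r := rfl

@[simp] theorem singleJob_headSize (r : ℕ) (p : ℝ) (hp : 0 < p) (b : Bool) :
    (singleJob r p hp b).headSize = p := rfl

@[simp] theorem singleJob_workload (r : ℕ) (p : ℝ) (hp : 0 < p) (b : Bool) :
    (singleJob r p hp b).workload = p := by
  simp [Job.workload, singleJob]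

@[simp] theorem unitJob_release (r : ℕ) : (unitJob r).release = r := rfl

@[simp] theorem unitJob_headSize (r : ℕ) : (unitJob r).headSize = 1 := rfl

@[simp] theorem unitJob_workload (r : ℕ) : (unitJob r).workload = 1 := by
  simp [unitJob]

/-- A job of workload `α` with a non-preemptive task of size `β`. -/
def closingJob (r : ℕ) (α β : ℝ) (hα : 1 ≤ α) : Job where
  release := r
  release_nonneg := r.cast_nonneg
  tasks := (if h : 0 < β then [⟨β, h, false⟩] else []) ++
    (if h : 0 < α - β then [⟨α - β, h, true⟩] else [])
  tasks_ne_nil := by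
    by_cases h : 0 < β
    · simp [h]
    · have h' : 0 < α - β := by linarith
      simp only [h', dif_pos]
      simp

@[simp] theorem closingJob_release (r : ℕ) (α β : ℝ) (hα : 1 ≤ α) :
    (closingJob r α β hα).release = r := rfl

theorem closingJob_workload (r : ℕ) {α β : ℝ} (hα : 1 ≤ α) (hβ : 0 ≤ β) (hβα : β ≤ α) :
    (closingJob r α β hα).workload = α := by
  have e : (closingJob r α β hα).tasks = (if h : 0 < β then [⟨β, h, false⟩] else []) ++
    (if h : 0 < α - β then [⟨α - β, h, true⟩] else []) := rfl
  unfold Job.workload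
  rw [e]
  by_cases h : 0 < β <;> by_cases h' : 0 < α - β
  · simp only [h, h', dif_pos]
    simp
  · simp only [h, h', dif_pos]
    simp
    linarith
  · simp only [h, h', dif_pos]
    simp
    linarith
  · linarith

/-- The conditions on a job in an instance with parameters `α` and `β` and minimum workload `1`;
release dates are natural numbers. -/
def Job.Admissible (α β : ℝ) (J : Job) : Prop :=
  1 ≤ J.workload ∧ J.workload ≤ α ∧ (∀ T ∈ J.tasks, T.preemptive = false → T.size ≤ β) ∧
    ∃ n : ℕ, J.release = n

theorem singleJob_admissible {α β : ℝ} (r : ℕ) {p : ℝ} (hp : 0 < p) (b : Bool) (h1 : 1 ≤ p)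
    (hα : p ≤ α) (hβ : b = false → p ≤ β) : (singleJob r p hp b).Admissible α β :=
  ⟨by simpa, by simpa, by
    intro T hT
    obtain rfl : T = ⟨p, hp, b⟩ := by simpa [singleJob] using hT
    exact hβ, r, rfl⟩

theorem unitJob_admissible {α β : ℝ} (hα : 1 ≤ α) (r : ℕ) : (unitJob r).Admissible α β :=
  singleJob_admissible r one_pos true le_rfl hα (by simp)

theorem closingJob_admissible {α β : ℝ} (r : ℕ) (hα : 1 ≤ α) (hβ : 0 ≤ β) (hβα : β ≤ α) :
    (closingJob r α β hα).Admissible α β := by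
  refine ⟨by rwa [closingJob_workload r hα hβ hβα], (closingJob_workload r hα hβ hβα).le,
    fun T hT hpre => ?_, r, rfl⟩
  rcases List.mem_append.1 (show T ∈ (_ ++ _) from hT) with h | h
  · split_ifs at h
    · rw [List.mem_singleton.1 h]
    · simp at h
  · split_ifs at h
    · rw [List.mem_singleton.1 h] at hpre
      simp at hpre
    · simp at h

/-- The parameters of an instance of admissible jobs that contains a unit job and a closing job. -/
theorem Instance.parameters {α β : ℝ} (hα : 1 ≤ α) (hβ : 0 ≤ β) (hβα : β ≤ α) {ω : Instance}
    (h : ∀ J ∈ ω.jobs, J.Admissible α β) {r r' : ℕ} (hu : unitJob r ∈ ω.jobs)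
    (hc : closingJob r' α β hα ∈ ω.jobs) : ω.alpha = α ∧ ω.beta = β := by
  have h1 : ω.minWorkload = 1 := by
    refine IsLeast.csInf_eq ⟨⟨_, hu, (unitJob_workload r).symm⟩, ?_⟩
    rintro x ⟨J, hJ, rfl⟩
    exact (h J hJ).1
  have h2 : ω.maxWorkload = α := by
    refine IsGreatest.csSup_eq ⟨⟨_, hc, (closingJob_workload r' hα hβ hβα).symm⟩, ?_⟩
    rintro x ⟨J, hJ, rfl⟩
    exact (h J hJ).2.1
  have h3 : ω.eta = β := by
    rcases hβ.eq_or_lt with rfl | hβ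
    -- For `β = 0` admissibility rules out non-preemptive tasks, and `sSup ∅ = 0` is the intended
    -- value of `eta`.
    · have : {x | ∃ J ∈ ω.jobs, ∃ T ∈ J.tasks, T.preemptive = false ∧ x = T.size} = ∅ := by
        ext x
        simp only [Set.mem_ofPred_eq, Set.mem_empty_iff_false, iff_false]
        rintro ⟨J, hJ, T, hT, hp, -⟩
        exact absurd ((h J hJ).2.2.1 T hT hp) (not_le.2 T.size_pos)
      unfold Instance.eta
      rw [this, Real.sSup_empty]
    · refine IsGreatest.csSup_eq ⟨⟨_, hc, ⟨β, hβ, false⟩, ?_, rfl, rfl⟩, ?_⟩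
      · show _ ∈ _ ++ _
        simp [hβ]
      · rintro x ⟨J, hJ, T, hT, hp, rfl⟩
        exact (h J hJ).2.2.1 T hT hp
  simp [Instance.alpha, Instance.beta, h1, h2, h3]

/-! ### The stream of unit jobs and its plans -/

/-- The stream of jobs: `N` unit jobs at each of the times `T, …, T + L - 1`. -/
def stream (N T : ℕ) : ℕ → List Job
  | 0 => []
  | L + 1 => stream N T L ++ List.replicate N (unitJob (T + L))

/-- A plan for `c` unit jobs released at time `r`, with `d` of them on each machine from number
`a` on. -/
def gridPlan (r a d c : ℕ) : List Entry :=
  (List.range c).map fun u => ⟨unitJob r, a + u / d, (r + u % d : ℕ)⟩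

/-- A plan for `n` copies of a job, each started at time `s` on its own machine. -/
def parallelPlan (J : Job) (n : ℕ) (s : ℝ) : List Entry :=
  (List.range n).map fun j => ⟨J, j, s⟩

/-- The plan that processes each job of the stream at its release. -/
def streamPlan (N T : ℕ) : ℕ → List Entry
  | 0 => []
  | L + 1 => streamPlan N T L ++ gridPlan (T + L) 0 1 N

theorem map_job_gridPlan (r a d c : ℕ) :
    (gridPlan r a d c).map Entry.job = List.replicate c (unitJob r) := by
  simp [gridPlan, Function.comp_def, List.map_const']

theorem map_job_parallelPlan (J : Job) (n : ℕ) (s : ℝ) :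
    (parallelPlan J n s).map Entry.job = List.replicate n J := by
  simp [parallelPlan, Function.comp_def, List.map_const']

theorem map_job_streamPlan (N T L : ℕ) : (streamPlan N T L).map Entry.job = stream N T L := by
  induction L with
  | zero => rfl
  | succ L ih => rw [streamPlan, stream, List.map_append, ih, map_job_gridPlan]

/-- Division with remainder by `d` places job `u` on machine `a + u / d` in time slot `u % d`;
distinct jobs differ in one of the two. -/
theorem fits_gridPlan {N : ℕ} (r a d c : ℕ) (hd : 0 < d) (h : ∀ u < c, a + u / d < N) :
    Fits N r (r + d : ℕ) (gridPlan r a d c) := by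
  constructor
  · intro e he
    obtain ⟨u, hu, rfl⟩ := List.mem_map.1 he
    refine ⟨?_, ?_, ?_, h u (List.mem_range.1 hu)⟩
    · simp
    · simp
    · have : u % d + 1 ≤ d := Nat.mod_lt u hd
      have : ((u % d : ℕ) : ℝ) + 1 ≤ d := by exact_mod_cast this
      simp only [Entry.finish, unitJob_workload]
      push_cast
      linarith
  · refine List.pairwise_map.2 (List.Pairwise.imp ?_ (List.nodup_range (n := c)))
    intro u v huv
    by_cases hm : u / d = v / d
    · have hne : u % d ≠ v % d := by
        intro hmod
        exact huv (by rw [← Nat.div_add_mod u d, ← Nat.div_add_mod v d, hm, hmod])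
      refine Or.inr ?_
      simp only [Entry.finish, unitJob_workload]
      norm_cast
      omega
    · exact Or.inl (by simpa using hm)

theorem fits_parallelPlan {N : ℕ} (J : Job) {n : ℕ} {s : ℝ} (hn : n ≤ N) (hs : J.release ≤ s) :
    Fits N s (s + J.workload) (parallelPlan J n s) := by
  constructor
  · intro e he
    obtain ⟨u, hu, rfl⟩ := List.mem_map.1 he
    exact ⟨le_rfl, hs, le_rfl, (List.mem_range.1 hu).trans_le hn⟩
  · exact List.pairwise_map.2 (List.Pairwise.imp (fun h => Or.inl h) (List.nodup_range (n := n)))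

theorem fits_streamPlan (N T L : ℕ) : Fits N T (T + L : ℕ) (streamPlan N T L) := by
  induction L with
  | zero => exact Fits.nil
  | succ L ih =>
    refine ih.append (fits_gridPlan (T + L) 0 1 N one_pos (by simp)) ?_ ?_
    · push_cast; linarith [L.cast_nonneg (α := ℝ)]
    · push_cast; linarith

theorem exists_stream_eq (N T : ℕ) {L s : ℕ} (h : s < L) :
    ∃ Y Y', stream N T L = Y ++ List.replicate N (unitJob (T + s)) ++ Y' := by
  induction L with
  | zero => omega
  | succ L ih =>
    rcases Nat.lt_succ_iff_lt_or_eq.1 h with h | rfl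
    · obtain ⟨Y, Y', e⟩ := ih h
      exact ⟨Y, Y' ++ List.replicate N (unitJob (T + L)), by
        rw [stream, e, List.append_assoc _ Y' _]⟩
    · exact ⟨stream N T s, [], by rw [stream, List.append_nil]⟩

theorem mem_stream {N T L : ℕ} {J : Job} (h : J ∈ stream N T L) :
    ∃ s < L, J = unitJob (T + s) := by
  induction L with
  | zero => simp [stream] at h
  | succ L ih =>
    rcases List.mem_append.1 h with h | h
    · obtain ⟨s, hs, rfl⟩ := ih h
      exact ⟨s, by omega, rfl⟩
    · exact ⟨L, by omega, List.eq_of_mem_replicate h⟩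

theorem stream_sorted (N T L : ℕ) :
    (stream N T L).Pairwise fun J J' => J.release ≤ J'.release := by
  induction L with
  | zero => exact List.Pairwise.nil
  | succ L ih =>
    refine List.pairwise_append.2 ⟨ih, List.pairwise_replicate.2 (Or.inr le_rfl), ?_⟩
    intro J hJ J' hJ'
    obtain ⟨s, hs, rfl⟩ := mem_stream hJ
    rw [List.eq_of_mem_replicate hJ']
    simp only [unitJob_release, Nat.cast_le]
    omega

/-- The backlog does not decrease during the stream. -/
theorem Feasible.backlog_stream {N : ℕ} {ω : Instance} {σ : Schedule N} (hσ : Feasible ω σ)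
    {C : Set ℝ} (hC : 1 ∈ C) {X Y : List Job} {T L : ℕ} (hω : ω.jobs = X ++ stream N T L ++ Y)
    {s s' : ℕ} (hss : s ≤ s') (hs : s' ≤ L) :
    backlog ω σ C (T + s : ℕ) ≤ backlog ω σ C (T + s' : ℕ) := by
  induction s', hss using Nat.le_induction with
  | base => rfl
  | succ s' _ ih =>
    refine (ih (by omega)).trans ?_
    obtain ⟨Z, Z', hZ⟩ := exists_stream_eq N T (show s' < L by omega)
    -- In one unit of time the machines remove at most `N` from the backlog, and the batch released
    -- at `T + s'` adds exactly `N` back.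
    have h1 := hσ.backlog_ge C (t := (T + s' : ℕ)) (t' := (T + (s' + 1) : ℕ))
      (Nat.cast_nonneg _) (by exact_mod_cast by omega)
    have h2 := arrived_sub_arrived_ge (X ++ Z) (List.replicate N (unitJob (T + s'))) (Z' ++ Y) C
      (t := (T + s' : ℕ)) (t' := (T + (s' + 1) : ℕ)) (by exact_mod_cast by omega) (by
        intro J hJ
        rw [List.eq_of_mem_replicate hJ]
        refine ⟨le_rfl, ?_, hC⟩
        rw [unitJob_release]
        exact_mod_cast by omega)
    have h3 : ω.jobs = X ++ Z ++ List.replicate N (unitJob (T + s')) ++ (Z' ++ Y) := by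
      rw [hω, hZ]
      simp [List.append_assoc]
    rw [← h3] at h2
    simp only [List.map_replicate, unitJob_headSize, List.sum_replicate, nsmul_eq_mul] at h2
    push_cast at *
    linarith

theorem cost_gridPlan_one (N T : ℕ) :
    ((gridPlan T 0 1 N).map fun e => e.finish - e.job.release).sum = N := by
  have : (gridPlan T 0 1 N).map (fun e => e.finish - e.job.release) = List.replicate N 1 := by
    refine List.eq_replicate_iff.2 ⟨by simp [gridPlan], fun x hx => ?_⟩
    simp only [gridPlan, List.map_map, List.mem_map] at hx
    obtain ⟨u, -, rfl⟩ := hx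
    simp [Entry.finish, Nat.mod_one]
  rw [this]
  simp

theorem cost_streamPlan (N T L : ℕ) :
    ((streamPlan N T L).map fun e => e.finish - e.job.release).sum = N * L := by
  induction L with
  | zero => simp [streamPlan]
  | succ L ih =>
    rw [streamPlan, List.map_append, List.sum_append, ih, cost_gridPlan_one]
    push_cast
    ring

theorem cost_parallelPlan (J : Job) (n : ℕ) (s : ℝ) :
    ((parallelPlan J n s).map fun e => e.finish - e.job.release).sum =
      n * (s + J.workload - J.release) := by
  have : (parallelPlan J n s).map (fun e => e.finish - e.job.release) =
      List.replicate n (s + J.workload - J.release) := by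
    refine List.eq_replicate_iff.2 ⟨by simp [parallelPlan], fun x hx => ?_⟩
    simp only [parallelPlan, List.map_map, List.mem_map] at hx
    obtain ⟨u, -, rfl⟩ := hx
    simp [Entry.finish]
  rw [this]
  simp

/-! ### The endgame -/

theorem OnlineAlgorithm.le_competitiveRatio {N : ℕ} (A : OnlineAlgorithm N) {ω : Instance}
    {α β c : ℝ} (h : ω.alpha = α ∧ ω.beta = β)
    (hc : c * optCost N ω ≤ totalResponse ω (A.schedule ω)) :
    (c : EReal) ≤ A.competitiveRatio α β := by
  refine le_trans ?_ (le_iSup₂ (f := fun (ω : Instance) (_ : ω.alpha = α ∧ ω.beta = β) =>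
    ((totalResponse ω (A.schedule ω) / optCost N ω : ℝ) : EReal)) ω h)
  exact EReal.coe_le_coe_iff.2 ((le_div_iff₀ (A.feasible ω).optCost_pos).2 hc)

/-- The adversary's endgame: an initial list of jobs, which a plan completes until time `T` except
for `n ≤ N` copies of the job `J`, is followed by a long stream of unit jobs. If the online
algorithm has `B` pending jobs throughout the stream, its competitive ratio is at least
`B / (6 * N)`. -/
theorem OnlineAlgorithm.endgame {N : ℕ} (hN : 0 < N) (A : OnlineAlgorithm N) {α β : ℝ}
    (hα : 1 ≤ α) (hβ : 0 ≤ β) (hβα : β ≤ α) {X : List Entry} {J : Job} {n T K : ℕ} (hn : n ≤ N)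
    (hX : Fits N 0 T X) (hadm : ∀ J' ∈ X.map Entry.job, J'.Admissible α β)
    (hJ : J.Admissible α β) (hrel : ∀ J' ∈ X.map Entry.job, J'.release ≤ J.release)
    (hJT : J.release ≤ T)
    (hsort : (X.map Entry.job).Pairwise fun J J' => J.release ≤ J'.release) {B : ℝ} (hB : 0 ≤ B)
    (hpend : ∀ (L : ℕ) (ω : Instance) (Y : List Job),
      (∀ J' ∈ Y, (T + L : ℕ) ≤ J'.release) →
      ω.jobs = X.map Entry.job ++ List.replicate n J ++ stream N T L ++ Y →
      ∀ t : ℕ, T + K < t → t ≤ T + L → B ≤ pending ω (A.schedule ω) t) :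
    ((B / (6 * N) : ℝ) : EReal) ≤ A.competitiveRatio α β := by
  have hN' : (1 : ℝ) ≤ N := by exact_mod_cast hN
  -- `D` collects the part of the offline cost that does not grow with `L`. The rest is at most `2 *
  -- N * L`, so `L ≥ D` gives `3 * N * L`; `L ≥ 2 * K` keeps half of the stream after the delay `K`.
  set D : ℝ := (X.map fun e => e.finish - e.job.release).sum + N * (T + α) + α with hD
  obtain ⟨L, hL⟩ := exists_nat_ge (max 1 (max (2 * K : ℝ) D))
  have hL1 : (1 : ℝ) ≤ L := (le_max_left _ _).trans hL
  have hLK : (2 * K : ℝ) ≤ L := ((le_max_left _ _).trans (le_max_right _ _)).trans hL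
  have hLD : D ≤ L := ((le_max_right _ _).trans (le_max_right _ _)).trans hL
  have hL0 : 0 < L := by exact_mod_cast hL1
  set M := ⌈α⌉₊ with hM
  have hαM : α ≤ M := Nat.le_ceil α
  -- Released when the plan has finished everything else, so that it adds only `α` to the offline
  -- cost.
  set Z := closingJob (T + L + M) α β hα with hZ
  set plan : List Entry := X ++ parallelPlan J n (T + L : ℕ) ++ streamPlan N T L ++
    [⟨Z, 0, (T + L + M : ℕ)⟩] with hplan
  have hjobs : plan.map Entry.job =
      X.map Entry.job ++ List.replicate n J ++ stream N T L ++ [Z] := by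
    simp [hplan, map_job_parallelPlan, map_job_streamPlan]
  have hle : ∀ J' ∈ X.map Entry.job ++ List.replicate n J, J'.release ≤ J.release := by
    intro J' h
    rcases List.mem_append.1 h with h | h
    · exact hrel J' h
    · rw [List.eq_of_mem_replicate h]
  let ω : Instance := ⟨plan.map Entry.job, by rw [hjobs]; simp, by
    rw [hjobs]
    refine List.pairwise_append.2 ⟨List.pairwise_append.2 ⟨List.pairwise_append.2 ⟨hsort,
      List.pairwise_replicate.2 (Or.inr le_rfl), ?_⟩, stream_sorted N T L, ?_⟩,
      List.pairwise_singleton _ _, ?_⟩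
    · intro J₁ h₁ J₂ h₂
      rw [List.eq_of_mem_replicate h₂]
      exact hrel J₁ h₁
    · intro J₁ h₁ J₂ h₂
      obtain ⟨s, -, rfl⟩ := mem_stream h₂
      refine ((hle J₁ h₁).trans hJT).trans ?_
      simp
    · intro J₁ h₁ J₂ h₂
      rw [List.mem_singleton.1 h₂]
      have hZr : Z.release = (T + L + M : ℕ) := rfl
      rw [hZr]
      rcases List.mem_append.1 h₁ with h₁ | h₁
      · refine ((hle J₁ h₁).trans hJT).trans ?_
        exact_mod_cast by omega
      · obtain ⟨s, hs, rfl⟩ := mem_stream h₁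
        rw [unitJob_release]
        exact_mod_cast by omega⟩
  have hωjobs : ω.jobs = X.map Entry.job ++ List.replicate n J ++ stream N T L ++ [Z] := hjobs
  have hadmω : ∀ J' ∈ ω.jobs, J'.Admissible α β := by
    intro J' h
    rw [hωjobs] at h
    rcases List.mem_append.1 h with h | h
    · rcases List.mem_append.1 h with h | h
      · rcases List.mem_append.1 h with h | h
        · exact hadm J' h
        · rw [List.eq_of_mem_replicate h]
          exact hJ
      · obtain ⟨s, -, rfl⟩ := mem_stream h
        exact unitJob_admissible hα _
    · rw [List.mem_singleton.1 h]
      exact closingJob_admissible _ hα hβ hβα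
  have hu : unitJob (T + 0) ∈ ω.jobs := by
    obtain ⟨Y, Y', e⟩ := exists_stream_eq N T hL0
    rw [hωjobs, e]
    simp [hN.ne']
  have hpar := ω.parameters hα hβ hβα hadmω hu (r' := T + L + M) (by rw [hωjobs]; simp [hZ])
  have hZw : Z.workload = α := closingJob_workload _ hα hβ hβα
  have hfits : Fits N 0 (T + L + M + α : ℝ) plan := by
    have h1 : Fits N 0 (T + L : ℕ) (X ++ streamPlan N T L) :=
      hX.append (fits_streamPlan N T L) (Nat.cast_nonneg _) (by simp)
    have h2 : Fits N (T + L : ℕ) (T + L + M : ℕ) (parallelPlan J n (T + L : ℕ)) := by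
      refine (fits_parallelPlan J hn (hJT.trans (by simp))).mono le_rfl ?_
      have := hJ.2.1
      push_cast
      linarith
    have h3 : Fits N (T + L + M : ℕ) (T + L + M + α : ℝ) [⟨Z, 0, (T + L + M : ℕ)⟩] := by
      refine ⟨?_, List.pairwise_singleton _ _⟩
      intro e he
      rw [List.mem_singleton.1 he]
      refine ⟨le_rfl, le_rfl, ?_, hN⟩
      simp [Entry.finish, hZw]
    have h4 := (h1.append h2 (Nat.cast_nonneg _) (by simp)).append h3 (Nat.cast_nonneg _)
      (by push_cast; linarith)
    -- The copies of `J` are listed by release before the stream but run after it; consistency of a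
    -- plan ignores the order of the list.
    refine h4.perm ?_
    refine List.Perm.append_right _ ?_
    rw [List.append_assoc, List.append_assoc]
    exact List.Perm.append_left _ List.perm_append_comm
  have hopt : optCost N ω ≤ 3 * N * L := by
    refine (optCost_le_of_plan rfl hfits).trans ?_
    rw [hplan]
    simp only [List.map_append, List.sum_append, cost_streamPlan, cost_parallelPlan]
    have e1 : ([(⟨Z, 0, (T + L + M : ℕ)⟩ : Entry)].map fun e => e.finish - e.job.release).sum
        = α := by
      have : Z.release = (T + L + M : ℕ) := rfl
      simp [Entry.finish, hZw, this]
    rw [e1]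
    have e2 : (n : ℝ) * ((T + L : ℕ) + J.workload - J.release) ≤ N * (T + L + α) := by
      have hn' : (n : ℝ) ≤ N := by exact_mod_cast hn
      have h1 := hJ.1
      have h2 := hJ.2.1
      have h3 := J.release_nonneg
      refine mul_le_mul hn' (by push_cast; linarith) ?_ (Nat.cast_nonneg _)
      push_cast
      have := L.cast_nonneg (α := ℝ)
      linarith
    have e3 : D ≤ N * L := hLD.trans (le_mul_of_one_le_left (by linarith) hN')
    have : (N : ℝ) * (T + L + α) = N * (T + α) + N * L := by ring
    linarith
  refine A.le_competitiveRatio (ω := ω) hpar ?_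
  have hcost := (A.feasible ω).sum_pending_le (fun J h => (hadmω J h).2.2.2) (T + K) (T + L)
  have hKL : K ≤ L := by
    have : (K : ℝ) ≤ L := by linarith [K.cast_nonneg (α := ℝ)]
    exact_mod_cast this
  have hlow : B * (L - K) ≤ ∑ t ∈ Finset.Ioc (T + K) (T + L), pending ω (A.schedule ω) t := by
    have h1 := Finset.card_nsmul_le_sum (Finset.Ioc (T + K) (T + L))
      (fun t : ℕ => pending ω (A.schedule ω) t) B (fun t ht => by
        rw [Finset.mem_Ioc] at ht
        refine hpend L ω [Z] ?_ hωjobs t ht.1 ht.2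
        intro J' h'
        rw [List.mem_singleton.1 h', hZ, closingJob_release]
        exact_mod_cast by omega)
    rw [Nat.card_Ioc, nsmul_eq_mul, show T + L - (T + K) = L - K by omega, Nat.cast_sub hKL] at h1
    linarith
  calc B / (6 * N) * optCost N ω ≤ B / (6 * N) * (3 * N * L) := by gcongr
    _ = B * (L / 2) := by field_simp; ring
    _ ≤ B * (L - K) := by gcongr; linarith
    _ ≤ _ := hlow.trans hcost

theorem stream_add (N T a b : ℕ) : stream N T (a + b) = stream N T a ++ stream N (T + a) b := by
  induction b with
  | zero => simp [stream]
  | succ b ih => rw [← add_assoc, stream, ih, stream, List.append_assoc, add_assoc]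

theorem sum_headSize_stream (N T L : ℕ) : ((stream N T L).map Job.headSize).sum = N * L := by
  induction L with
  | zero => simp [stream]
  | succ L ih =>
    rw [stream, List.map_append, List.sum_append, ih]
    simp
    ring

theorem arrived_nonneg (l : List Job) (C : Set ℝ) (t : ℝ) : 0 ≤ arrived l C t := by
  refine List.sum_nonneg fun x hx => ?_
  obtain ⟨J, -, rfl⟩ := List.mem_map.1 hx
  have := J.headSize_pos
  split_ifs <;> linarith

/-! ### The bound in terms of `β` -/

/-- If `N` non-preemptive jobs of size `p` are released at time `0` and all others later, a
work-conserving schedule processes only them until time `p`. -/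
theorem WorkConservingSchedule.runs_initial {N : ℕ} {ω : Instance} {σ : Schedule N}
    (hσ : Feasible ω σ) (hw : WorkConservingSchedule ω σ) {p : ℝ} {hp : 0 < p} {Y : List Job}
    (hω : ω.jobs = List.replicate N (singleJob 0 p hp false) ++ Y)
    (hY : ∀ J ∈ Y, 0 < J.release) (m : Fin N) :
    ∃ i < N, ∀ t, 0 ≤ t → t < p → σ m t = some (i, 0) := by
  have htask : ∀ i < N, ω.HasTask (i, 0) (singleJob 0 p hp false) ⟨p, hp, false⟩ := by
    intro i hi
    refine ⟨?_, rfl⟩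
    rw [hω, List.getElem?_append_left (by simpa using hi)]
    simp [hi]
  have hbusy : σ m 0 ≠ none := by
    -- If `m` were idle, all `N` initial tasks would run at time 0 on distinct machines, and one of
    -- these would have to be `m`.
    intro hidle
    have hrun : ∀ i : Fin N, ∃ m', σ m' 0 = some ((i : ℕ), 0) := by
      intro i
      refine hw 0 ⟨m, hidle⟩ _ _ _ (htask i i.2) (by simp) ?_
      rw [hσ.work_eq_zero_of_le_release (htask i i.2).1 (by simp)]
      exact hp
    choose f hf using hrun
    have hinj : Function.Injective f := by
      intro i j hij
      have h1 := hf i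
      rw [hij, hf j] at h1
      exact Fin.ext (congrArg Prod.fst (Option.some.inj h1)).symm
    obtain ⟨i, rfl⟩ := Finite.surjective_of_injective hinj m
    rw [hf i] at hidle
    exact absurd hidle (by simp)
  obtain ⟨⟨i, ℓ⟩, hτ⟩ := Option.ne_none_iff_exists'.1 hbusy
  obtain ⟨J, T, hJT, hJ⟩ := hσ.released m _ 0 hτ
  have hi : i < N := by
    by_contra! hi
    have h1 : ω.jobs[i]? = some J := hJT.1
    rw [hω, List.getElem?_append_right (by simpa using hi)] at h1
    exact absurd (hY J (List.mem_of_getElem? h1)) (not_lt.2 hJ)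
  obtain rfl : singleJob 0 p hp false = J := Option.some.inj ((htask i hi).1.symm.trans hJT.1)
  have hℓ : ℓ = 0 := by
    have h1 : (singleJob 0 p hp false).tasks[ℓ]? = some T := hJT.2
    obtain ⟨h2, -⟩ := List.getElem?_eq_some_iff.1 h1
    simpa [singleJob] using h2
  subst hℓ
  obtain ⟨m', s, hs⟩ := hσ.nonpreemptive (i, 0) _ _ (htask i hi) rfl
  obtain ⟨rfl, hs0, hs1⟩ := (hs m 0).1 hτ
  dsimp only at hs hs1
  -- Processing cannot start before a release date, so `s ≥ 0`; the task runs at time 0, so its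
  -- interval is `[0, p)`.
  obtain ⟨J', T', hJ', hr⟩ := hσ.released m _ s ((hs m s).2 ⟨rfl, le_rfl, by linarith⟩)
  have hs2 : 0 ≤ s := J'.release_nonneg.trans hr
  exact ⟨i, hi, fun t h0 h1 => (hs m t).2 ⟨rfl, by linarith, by linarith⟩⟩

theorem OnlineAlgorithm.WorkConserving.beta_bound {N : ℕ} (hN : 0 < N) {A : OnlineAlgorithm N}
    (hA : A.WorkConserving) {α β : ℝ} (hβ : 2 ≤ β) (hβα : β ≤ α) :
    ((β / 18 : ℝ) : EReal) ≤ A.competitiveRatio α β := by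
  have hβ0 : 0 < β := by linarith
  have hN' : (0 : ℝ) < N := by exact_mod_cast hN
  set m := ⌊β⌋₊ with hm
  have hm2 : 2 ≤ m := Nat.le_floor hβ
  have hmβ : (m : ℝ) ≤ β := Nat.floor_le hβ0.le
  have hβm : β < m + 1 := Nat.lt_floor_add_one β
  -- The stream starts at time 1, so that at time 0 only the long jobs are available. The offline
  -- plan postpones all of them.
  have hend := A.endgame hN (α := α) (β := β) (by linarith) hβ0.le hβα (X := [])
    (J := singleJob 0 β hβ0 false) (n := N) (T := 1) (K := m) (B := N * β / 3) le_rfl Fits.nil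
    (by simp) (singleJob_admissible 0 hβ0 false (by linarith) hβα (fun _ => le_rfl)) (by simp)
    (by simp) (by simp) (by positivity) ?_
  · convert hend using 2
    field_simp
    norm_num
  intro L ω Y hY hω t ht1 ht2
  rw [List.map_nil, List.nil_append] at hω
  set σ := A.schedule ω with hσdef
  have hσ : Feasible ω σ := A.feasible ω
  have hlater : ∀ J ∈ stream N 1 L ++ Y, 0 < J.release := by
    intro J hJ
    rcases List.mem_append.1 hJ with h | h
    · obtain ⟨s, -, rfl⟩ := mem_stream h
      rw [unitJob_release]
      exact_mod_cast by omega
    · refine lt_of_lt_of_le ?_ (hY J h)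
      exact_mod_cast by omega
  have hrun := fun k : Fin N => (hA ω).runs_initial hσ
    (by rw [hω, List.append_assoc]) hlater k
  have hbig : ∀ i : Fin ω.jobs.length, i.1 < N → ω.jobs[i].headSize = β := by
    intro i hi
    have h1 : ω.jobs[i.1]? = some (singleJob 0 β hβ0 false) := by
      simp only [hω]
      rw [List.append_assoc, List.getElem?_append_left (by simpa using hi)]
      simp [hi]
    rw [show ω.jobs[i] = singleJob 0 β hβ0 false from (List.getElem?_eq_some_iff.1 h1).2]
    rfl
  have hzero : ∀ i : Fin ω.jobs.length, N ≤ i.1 → σ.work (i, 0) m = 0 := by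
    intro i hi
    refine σ.work_eq_zero _ fun s hs0 hs1 => ?_
    rintro ⟨k, hk⟩
    obtain ⟨j, hj, hj'⟩ := hrun k
    rw [hj' s hs0 (hs1.trans_le hmβ)] at hk
    have : j = i.1 := congrArg Prod.fst (Option.some.inj hk)
    omega
  have hback : backlog ω σ (Set.Iic 1) m = arrived ω.jobs (Set.Iic 1) m := by
    classical
    rw [hσ.backlog_eq, Finset.sum_eq_zero, sub_zero]
    intro i hi
    refine hzero i ?_
    by_contra! hlt
    have h1 := (Finset.mem_filter.1 hi).2
    rw [hbig i hlt, Set.mem_Iic] at h1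
    linarith
  -- The batches released at `1, …, m - 1` have all arrived before time `m` and are untouched.
  have harr : (N : ℝ) * (m - 1) ≤ arrived ω.jobs (Set.Iic 1) m := by
    have h1 := arrived_sub_arrived_ge (List.replicate N (singleJob 0 β hβ0 false))
      (stream N 1 (m - 1)) (stream N (1 + (m - 1)) (L - (m - 1)) ++ Y) (Set.Iic 1)
      (t := 0) (t' := m) (Nat.cast_nonneg _) (by
        intro J hJ
        obtain ⟨s, hs, rfl⟩ := mem_stream hJ
        refine ⟨Job.release_nonneg _, ?_, by simp⟩
        rw [unitJob_release]
        exact_mod_cast by omega)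
    have h2 : ω.jobs = List.replicate N (singleJob 0 β hβ0 false) ++ stream N 1 (m - 1) ++
        (stream N (1 + (m - 1)) (L - (m - 1)) ++ Y) := by
      rw [hω, show stream N 1 L = stream N 1 ((m - 1) + (L - (m - 1))) by congr 1; omega,
        stream_add]
      simp only [List.append_assoc]
    rw [← h2, sum_headSize_stream, Nat.cast_sub (by omega)] at h1
    have := arrived_nonneg ω.jobs (Set.Iic 1) 0
    push_cast at h1
    linarith
  have hstream := hσ.backlog_stream (C := Set.Iic 1) (by simp) hω
    (show m - 1 ≤ t - 1 by omega) (show t - 1 ≤ L by omega)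
  rw [show 1 + (m - 1) = m by omega, show 1 + (t - 1) = t by omega, hback] at hstream
  refine le_trans ?_ (harr.trans (hstream.trans (hσ.backlog_le_pending t)))
  have hm2' : (2 : ℝ) ≤ m := by exact_mod_cast hm2
  rw [mul_div_assoc]
  gcongr
  -- From `β < m + 1` and `2 ≤ m` it follows that `β / 3 ≤ m - 1`.
  linarith

theorem OnlineAlgorithm.one_le_competitiveRatio {N : ℕ} (A : OnlineAlgorithm N) {α β : ℝ}
    (hα : 1 ≤ α) (hβ : 0 ≤ β) (hβα : β ≤ α) : 1 ≤ A.competitiveRatio α β := by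
  let ω : Instance := ⟨[unitJob 0, closingJob 0 α β hα], by simp, by simp⟩
  have hpar : ω.alpha = α ∧ ω.beta = β := by
    refine ω.parameters hα hβ hβα (r := 0) (r' := 0) ?_ (by simp [ω]) (by simp [ω])
    intro J hJ
    rcases List.mem_pair.1 hJ with rfl | rfl
    · exact unitJob_admissible hα 0
    · exact closingJob_admissible 0 hα hβ hβα
  have h := A.le_competitiveRatio (c := 1) hpar (by
    rw [one_mul]
    exact (A.feasible ω).optCost_le)
  exact_mod_cast h

/-! ### Phases with geometrically decreasing long jobs -/

/-- The time at which phase `j` starts if phase `i` takes time `2 * q i`. -/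
def phaseStart (q : ℕ → ℕ) : ℕ → ℕ
  | 0 => 0
  | j + 1 => phaseStart q j + 2 * q j

theorem phaseStart_mono (q : ℕ → ℕ) : Monotone (phaseStart q) :=
  monotone_nat_of_le_succ fun j => by rw [phaseStart]; omega

section Phases

variable (N : ℕ) (q : ℕ → ℕ) (hq : ∀ j, 0 < q j)

/-- The long job of phase `j`. -/
def longJob (j : ℕ) : Job :=
  singleJob (phaseStart q j) (2 * q j) (by have := hq j; positivity) true

/-- The jobs of the first `j` phases: phase `i` has `N * q i` unit jobs and `N / 2` long jobs. -/
def phases : ℕ → List Job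
  | 0 => []
  | j + 1 => phases j ++ (List.replicate (N * q j) (unitJob (phaseStart q j)) ++
      List.replicate (N / 2) (longJob q hq j))

/-- A plan that completes each phase within its time window. -/
def phasesPlan : ℕ → List Entry
  | 0 => []
  | j + 1 => phasesPlan j ++ (gridPlan (phaseStart q j) (N / 2) (2 * q j) (N * q j) ++
      parallelPlan (longJob q hq j) (N / 2) (phaseStart q j))

variable {q}

theorem map_job_phasesPlan (j : ℕ) : (phasesPlan N q hq j).map Entry.job = phases N q hq j := by
  induction j with
  | zero => rfl
  | succ j ih =>
    rw [phasesPlan, phases, List.map_append, List.map_append, ih, map_job_gridPlan,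
      map_job_parallelPlan]

theorem longJob_workload (j : ℕ) : (longJob q hq j).workload = 2 * q j := by
  simp [longJob]

theorem longJob_headSize (j : ℕ) : (longJob q hq j).headSize = 2 * q j := rfl

theorem longJob_release (j : ℕ) : (longJob q hq j).release = phaseStart q j := rfl

theorem fits_phasesPlan (j : ℕ) : Fits N 0 (phaseStart q j) (phasesPlan N q hq j) := by
  induction j with
  | zero => exact Fits.nil
  | succ j ih =>
    refine ih.append (b := phaseStart q j) ?_ (Nat.cast_nonneg _)
      (by exact_mod_cast phaseStart_mono q (Nat.le_succ j))
    have h1 : Fits N (phaseStart q j) (phaseStart q j + 2 * q j : ℕ)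
        (gridPlan (phaseStart q j) (N / 2) (2 * q j) (N * q j)) := by
      refine fits_gridPlan _ _ _ _ (by have := hq j; omega) fun u hu => ?_
      -- The machines not used by long jobs number `N - N / 2 ≥ N / 2` (real half), enough for `N *
      -- q j` unit jobs in a window of length `2 * q j`.
      have h2 : u / (2 * q j) < N - N / 2 := by
        rw [Nat.div_lt_iff_lt_mul (by have := hq j; omega)]
        calc u < N * q j := hu
          _ ≤ (2 * (N - N / 2)) * q j := Nat.mul_le_mul_right _ (by omega)
          _ = _ := by ring
      omega
    have h2 := fits_parallelPlan (N := N) (longJob q hq j) (n := N / 2) (s := phaseStart q j)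
      (Nat.div_le_self _ _) le_rfl
    rw [longJob_workload] at h2
    refine ⟨fun e he => ?_, List.pairwise_append.2 ⟨h1.2, h2.2, ?_⟩⟩
    · rcases List.mem_append.1 he with he | he
      · exact h1.1 e he
      · simpa [phaseStart] using h2.1 e he
    · intro e he e' he'
      obtain ⟨u, -, rfl⟩ := List.mem_map.1 he
      obtain ⟨v, hv, rfl⟩ := List.mem_map.1 he'
      have := List.mem_range.1 hv
      exact Or.inl (this.trans_le (Nat.le_add_right _ _)).ne'

theorem mem_phases {j : ℕ} {J : Job} (h : J ∈ phases N q hq j) :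
    ∃ i < j, J = unitJob (phaseStart q i) ∨ J = longJob q hq i := by
  induction j with
  | zero => simp [phases] at h
  | succ j ih =>
    rcases List.mem_append.1 h with h | h
    · obtain ⟨i, hi, h⟩ := ih h
      exact ⟨i, by omega, h⟩
    · refine ⟨j, by omega, ?_⟩
      rcases List.mem_append.1 h with h | h
      · exact Or.inl (List.eq_of_mem_replicate h)
      · exact Or.inr (List.eq_of_mem_replicate h)

theorem release_of_mem_phases {j : ℕ} {J : Job} (h : J ∈ phases N q hq j) :
    ∃ i < j, J.release = phaseStart q i := by
  obtain ⟨i, hi, rfl | rfl⟩ := mem_phases N hq h <;> exact ⟨i, hi, rfl⟩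

theorem release_le_of_mem_phases {j : ℕ} {J : Job} (h : J ∈ phases N q hq j) :
    J.release ≤ phaseStart q j := by
  obtain ⟨i, hi, e⟩ := release_of_mem_phases N hq h
  rw [e]
  exact_mod_cast phaseStart_mono q hi.le

theorem phases_sorted (j : ℕ) :
    (phases N q hq j).Pairwise fun J J' => J.release ≤ J'.release := by
  induction j with
  | zero => exact List.Pairwise.nil
  | succ j ih =>
    refine List.pairwise_append.2 ⟨ih, List.pairwise_append.2
      ⟨List.pairwise_replicate.2 (Or.inr le_rfl), List.pairwise_replicate.2 (Or.inr le_rfl), ?_⟩,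
      ?_⟩
    · intro J hJ J' hJ'
      rw [List.eq_of_mem_replicate hJ, List.eq_of_mem_replicate hJ']
      rfl
    · intro J hJ J' hJ'
      have h1 : J'.release = phaseStart q j := by
        rcases List.mem_append.1 hJ' with h | h <;> rw [List.eq_of_mem_replicate h] <;> rfl
      rw [h1]
      exact release_le_of_mem_phases N hq hJ

theorem phases_prefix {i k : ℕ} (h : i ≤ k) :
    ∃ Y, phases N q hq k = phases N q hq i ++ Y ∧ ∀ J ∈ Y, (phaseStart q i : ℝ) ≤ J.release := by
  induction k, h using Nat.le_induction with
  | base => exact ⟨[], by simp, by simp⟩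
  | succ k hk ih =>
    obtain ⟨Y, e, hY⟩ := ih
    refine ⟨Y ++ _, by rw [phases, e, List.append_assoc], fun J hJ => ?_⟩
    rcases List.mem_append.1 hJ with h | h
    · exact hY J h
    · have h1 : J.release = phaseStart q k := by
        rcases List.mem_append.1 h with h | h <;> rw [List.eq_of_mem_replicate h] <;> rfl
      rw [h1]
      exact_mod_cast phaseStart_mono q hk

theorem phases_admissible {α β : ℝ} (hα : 1 ≤ α) (hqα : ∀ j, (2 * q j : ℝ) ≤ α) {j : ℕ} {J : Job}
    (h : J ∈ phases N q hq j) : J.Admissible α β := by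
  obtain ⟨i, -, rfl | rfl⟩ := mem_phases N hq h
  · exact unitJob_admissible hα _
  · have h1 : (1 : ℝ) ≤ q i := by exact_mod_cast hq i
    exact singleJob_admissible _ _ _ (by linarith) (hqα i) (by simp)

variable {N} {ω : Instance} {σ : Schedule N} {k : ℕ} {Y : List Job}

/-- The work released in phase `j`. -/
theorem arrived_phase (hω : ω.jobs = phases N q hq k ++ Y) {j : ℕ} (hj : j < k) {θ t : ℝ}
    (hθ : (2 * q j : ℝ) ≤ θ) (ht : (phaseStart q j : ℝ) < t) :
    (N * q j + (N / 2 : ℕ) * (2 * q j) : ℝ) ≤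
      arrived ω.jobs (Set.Iic θ) t - arrived ω.jobs (Set.Iic θ) (phaseStart q j) := by
  obtain ⟨Y', e, -⟩ := phases_prefix N hq (Nat.succ_le_of_lt hj)
  have h1 : (1 : ℝ) ≤ q j := by exact_mod_cast hq j
  have h := arrived_sub_arrived_ge (phases N q hq j)
    (List.replicate (N * q j) (unitJob (phaseStart q j)) ++
      List.replicate (N / 2) (longJob q hq j)) (Y' ++ Y) (Set.Iic θ) ht.le (by
    intro J hJ
    rcases List.mem_append.1 hJ with h | h
    · rw [List.eq_of_mem_replicate h]
      exact ⟨le_rfl, ht, by rw [unitJob_headSize, Set.mem_Iic]; linarith⟩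
    · rw [List.eq_of_mem_replicate h]
      exact ⟨le_rfl, ht, by rwa [longJob_headSize, Set.mem_Iic]⟩)
  have e' : phases N q hq j ++ (List.replicate (N * q j) (unitJob (phaseStart q j)) ++
      List.replicate (N / 2) (longJob q hq j)) ++ (Y' ++ Y) = ω.jobs := by
    rw [hω, e, Nat.succ_eq_add_one, phases]
    simp only [List.append_assoc]
  rw [e'] at h
  refine le_trans (le_of_eq ?_) h
  simp [longJob_headSize]

/-- Until the end of phase `i`, only `N / 2` jobs of intermediate size have been released. -/
theorem arrivedCount_phase (hω : ω.jobs = phases N q hq k ++ Y)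
    (hY : ∀ J ∈ Y, (phaseStart q k : ℝ) ≤ J.release) (hanti : ∀ i j, i < j → j < k → q j < q i)
    {i : ℕ} (hi : i < k) :
    arrivedCount ω.jobs (Set.Ioc 1 (2 * q i)) (phaseStart q (i + 1)) ≤ (N / 2 : ℕ) := by
  classical
  obtain ⟨Y', e, hY'⟩ := phases_prefix N hq (Nat.succ_le_of_lt hi)
  have e' : ω.jobs = phases N q hq i ++ (List.replicate (N * q i) (unitJob (phaseStart q i)) ++
      (List.replicate (N / 2) (longJob q hq i) ++ (Y' ++ Y))) := by
    rw [hω, e, Nat.succ_eq_add_one, phases]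
    simp only [List.append_assoc]
  have happ : ∀ l l' C t, arrivedCount (l ++ l') C t = arrivedCount l C t + arrivedCount l' C t := by
    intro l l' C t
    simp [arrivedCount]
  have hzero : ∀ (l : List Job) (C : Set ℝ) (t : ℝ),
      (∀ J ∈ l, t ≤ J.release ∨ J.headSize ∉ C) → arrivedCount l C t = 0 := by
    intro l C t h
    refine List.sum_eq_zero fun x hx => ?_
    obtain ⟨J, hJ, rfl⟩ := List.mem_map.1 hx
    rcases h J hJ with h | h
    · simp [not_lt.2 h]
    · simp [h]
  -- Unit jobs miss the half-open interval at 1, long jobs of earlier phases exceed `2 * q i`, and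
  -- the jobs in `Y' ++ Y` come too late; only the long jobs of phase `i` count.
  rw [e', happ, happ, happ, hzero (phases N q hq i), hzero (List.replicate (N * q i) _),
    hzero (Y' ++ Y), zero_add, zero_add, add_zero]
  · unfold arrivedCount
    refine (List.sum_le_card_nsmul _ 1 ?_).trans (by simp)
    intro x hx
    obtain ⟨J, -, rfl⟩ := List.mem_map.1 hx
    split_ifs <;> norm_num
  · intro J hJ
    left
    rcases List.mem_append.1 hJ with h | h
    · exact hY' J h
    · refine le_trans ?_ (hY J h)
      exact_mod_cast phaseStart_mono q hi
  · intro J hJ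
    right
    rw [List.eq_of_mem_replicate hJ]
    simp
  · intro J hJ
    right
    obtain ⟨j, hj, rfl | rfl⟩ := mem_phases N hq hJ
    · simp
    · rw [longJob_headSize, Set.mem_Ioc, not_and, not_le]
      intro _
      have : (q i : ℝ) < q j := by exact_mod_cast hanti j i hj hi
      linarith

/-- Equality holds for `N = 3`, the worst case of rounding `N / 2` down. -/
theorem le_three_mul_half (hN : 2 ≤ N) : (N : ℝ) ≤ 3 * (N / 2 : ℕ) := by
  exact_mod_cast by omega

/-- A schedule that has processed most unit jobs halfway through a phase leaves a large part of the
long jobs unprocessed at its end. -/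
theorem Feasible.backlog_phase (hσ : Feasible ω σ) (hN : 2 ≤ N)
    (hω : ω.jobs = phases N q hq k ++ Y)
    (hY : ∀ J ∈ Y, (phaseStart q k : ℝ) ≤ J.release) (hanti : ∀ i j, i < j → j < k → q j < q i)
    {i : ℕ} (hi : i < k)
    (hunit : backlog ω σ (Set.Iic 1) (phaseStart q i + q i : ℕ) < N * q i / 12) :
    (N * q i / 4 : ℝ) ≤ backlog ω σ (Set.Iic (2 * q i)) (phaseStart q (i + 1)) := by
  have hq1 : (1 : ℝ) ≤ q i := by exact_mod_cast hq i
  have h1 := hσ.backlog_ge (Set.Iic (2 * q i)) (t := phaseStart q i)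
    (t' := (phaseStart q i + q i : ℕ)) (Nat.cast_nonneg _) (by simp)
  have h2 := arrived_phase hq hω hi (θ := 2 * q i) (t := (phaseStart q i + q i : ℕ)) le_rfl
    (by push_cast; linarith)
  have h3 := hσ.backlog_nonneg (Set.Iic (2 * q i : ℝ)) (phaseStart q i)
  have h4 : Set.Iic (1 : ℝ) ∪ Set.Ioc 1 (2 * q i) = Set.Iic (2 * q i : ℝ) :=
    Set.Iic_union_Ioc_eq_Iic (by linarith)
  have h5 := backlog_union (ω := ω) (σ := σ) (C := Set.Iic (1 : ℝ)) (D := Set.Ioc 1 (2 * q i))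
    (Set.disjoint_left.2 fun x a b => not_lt.2 a b.1) (phaseStart q i + q i : ℕ)
  have h6 := hσ.backlog_ge_sub_count (Set.Ioc 1 (2 * q i : ℝ))
    (t := (phaseStart q i + q i : ℕ)) (t' := phaseStart q (i + 1)) (Nat.cast_nonneg _)
    (by rw [phaseStart]; exact_mod_cast by omega)
  have h7 := arrivedCount_phase hq hω hY hanti hi
  have h8 := hσ.backlog_mono (C := Set.Ioc 1 (2 * q i : ℝ)) (D := Set.Iic (2 * q i))
    (fun x hx => hx.2) (phaseStart q (i + 1))
  have h9 : ((phaseStart q (i + 1) : ℕ) : ℝ) - (phaseStart q i + q i : ℕ) = q i := by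
    rw [phaseStart]
    push_cast
    ring
  have h10 := mul_le_mul_of_nonneg_right (le_three_mul_half hN) (Nat.cast_nonneg (α := ℝ) (q i))
  have h11 := mul_le_mul_of_nonneg_right h7 (Nat.cast_nonneg (α := ℝ) (q i))
  rw [h4] at h5
  rw [h9] at h6
  push_cast at h1 h2 h3 h5 h6 h8 hunit ⊢
  -- With `h = ⌊N / 2⌋`, at least `2 * h * q i` is left at half-time, less than `N * q i / 12` of it
  -- in unit jobs. The second half removes at most `h * q i` of the long jobs' work, and `h ≥ N / 3`
  -- leaves `N * q i / 3 - N * q i / 12`.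
  linarith

/-- The backlog of phase `i` persists through the later phases. -/
theorem Feasible.backlog_phases (hσ : Feasible ω σ) (hN : 2 ≤ N)
    (hω : ω.jobs = phases N q hq k ++ Y)
    (hY : ∀ J ∈ Y, (phaseStart q k : ℝ) ≤ J.release) (hq8 : ∀ j, j + 1 < k → q j = 8 * q (j + 1))
    (hanti : ∀ i j, i < j → j < k → q j < q i) {i j : ℕ} (hij : i ≤ j) (hj : j < k)
    (hunit : backlog ω σ (Set.Iic 1) (phaseStart q i + q i : ℕ) < N * q i / 12) :
    (N * q i / 4 - N * (q i - q j) / 21 : ℝ) ≤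
      backlog ω σ (Set.Iic (2 * q i)) (phaseStart q (j + 1)) := by
  -- Phase `j + 1` removes at most `N * q (j + 1) / 3` net of its own arrivals. As `q j - q (j + 1)
  -- = 7 * q (j + 1)`, this is the telescoping increment `N * (q j - q (j + 1)) / 21`.
  induction j, hij using Nat.le_induction with
  | base => simpa using hσ.backlog_phase hq hN hω hY hanti hj hunit
  | succ j hij ih =>
    have ih := ih (by omega)
    have h1 := hσ.backlog_ge (Set.Iic (2 * q i)) (t := phaseStart q (j + 1))
      (t' := phaseStart q (j + 1 + 1)) (Nat.cast_nonneg _)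
      (by exact_mod_cast phaseStart_mono q (Nat.le_succ _))
    have hlt : (q (j + 1) : ℝ) < q i := by exact_mod_cast hanti i (j + 1) (by omega) hj
    have h2 := arrived_phase hq hω hj (θ := 2 * q i) (t := phaseStart q (j + 1 + 1))
      (by linarith) (by
        have := hq (j + 1)
        rw [phaseStart.eq_def q (j + 1 + 1)]
        exact_mod_cast by dsimp only; omega)
    have h3 : ((phaseStart q (j + 1 + 1) : ℕ) : ℝ) - phaseStart q (j + 1) = 2 * q (j + 1) := by
      rw [phaseStart.eq_def q (j + 1 + 1)]
      push_cast
      ring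
    have h4 := mul_le_mul_of_nonneg_right (le_three_mul_half hN)
      (Nat.cast_nonneg (α := ℝ) (q (j + 1)))
    have h5 : (q j : ℝ) = 8 * q (j + 1) := by exact_mod_cast hq8 j hj
    rw [h3] at h1
    rw [h5] at ih
    linarith

/-- The reciprocals at least double at each step, so each sum is dominated by its last nonzero term,
which is at most `1 / s`. -/
theorem sum_ite_inv_le {θ : ℕ → ℝ} {k : ℕ} (hθ : ∀ i < k, 0 < θ i)
    (h2 : ∀ i, i + 1 < k → 2 * θ (i + 1) ≤ θ i) {s : ℝ} (hs : 0 < s) :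
    ∑ i ∈ Finset.range k, (if s ≤ θ i then 1 / θ i else 0) ≤ 2 / s := by
  have hgeo : ∀ i < k, ∑ j ∈ Finset.range i, 1 / θ j ≤ 1 / θ i := by
    intro i hi
    induction i with
    | zero => simpa using (hθ 0 hi).le
    | succ i ih =>
      rw [Finset.sum_range_succ]
      have h1 := hθ (i + 1) hi
      have h3 : 1 / θ i ≤ 1 / (2 * θ (i + 1)) := one_div_le_one_div_of_le (by linarith) (h2 i hi)
      have h4 : 1 / (2 * θ (i + 1)) = 1 / θ (i + 1) / 2 := by field_simp
      linarith [ih (by omega)]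
  have key : ∀ m ≤ k, ∑ i ∈ Finset.range m, (if s ≤ θ i then 1 / θ i else 0) ≤ 2 / s := by
    intro m hm
    induction m with
    | zero => simp; positivity
    | succ m ih =>
      rw [Finset.sum_range_succ]
      split_ifs with h
      · have h1 : ∑ i ∈ Finset.range m, (if s ≤ θ i then 1 / θ i else 0) ≤
            ∑ i ∈ Finset.range m, 1 / θ i := by
          refine Finset.sum_le_sum fun i hi => ?_
          have := hθ i ((Finset.mem_range.1 hi).trans hm)
          split_ifs
          · rfl
          · positivity
        have h3 : 1 / θ m ≤ 1 / s := one_div_le_one_div_of_le hs h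
        have h4 : 2 / s = 1 / s + 1 / s := by ring
        linarith [hgeo m hm]
      · rw [add_zero]
        exact ih (by omega)
  exact key k le_rfl

/-- If no phase leaves many unit jobs at half-time, all `k` backlogs survive into the stream, and
each scale contributes `N / 12` to the weighted sum of `sum_backlog_div_le`. -/
theorem Feasible.pending_of_phases (hσ : Feasible ω σ) (hN : 2 ≤ N) {L : ℕ}
    (hω : ω.jobs = phases N q hq k ++ stream N (phaseStart q k) L ++ Y)
    (hY : ∀ J ∈ Y, ((phaseStart q k + L : ℕ) : ℝ) ≤ J.release)
    (hq8 : ∀ j, j + 1 < k → q j = 8 * q (j + 1)) (hanti : ∀ i j, i < j → j < k → q j < q i)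
    (hunit : ∀ i < k, backlog ω σ (Set.Iic 1) (phaseStart q i + q i : ℕ) < N * q i / 12)
    {s : ℕ} (hs : s ≤ L) : (N * k / 24 : ℝ) ≤ pending ω σ (phaseStart q k + s : ℕ) := by
  have hN0 : (0 : ℝ) ≤ N := N.cast_nonneg
  have hω' : ω.jobs = phases N q hq k ++ (stream N (phaseStart q k) L ++ Y) := by
    rw [hω, List.append_assoc]
  have hY' : ∀ J ∈ stream N (phaseStart q k) L ++ Y, (phaseStart q k : ℝ) ≤ J.release := by
    intro J hJ
    rcases List.mem_append.1 hJ with h | h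
    · obtain ⟨s, -, rfl⟩ := mem_stream h
      rw [unitJob_release]
      exact_mod_cast by omega
    · refine le_trans ?_ (hY J h)
      exact_mod_cast by omega
  have hq0 : ∀ i, (1 : ℝ) ≤ q i := fun i => by exact_mod_cast hq i
  have h1 := hσ.sum_backlog_div_le (k := k) (θ := fun i => 2 * q i)
    (fun i _ => by have := hq0 i; positivity)
    (fun s hs => sum_ite_inv_le (fun i _ => by have := hq0 i; positivity)
      (fun i hi => by
        have : (q i : ℝ) = 8 * q (i + 1) := by exact_mod_cast hq8 i hi
        have := hq0 (i + 1)
        linarith) hs) (phaseStart q k + s : ℕ)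
  have h2 : ∑ i ∈ Finset.range k, (N / 12 : ℝ) ≤ ∑ i ∈ Finset.range k,
      backlog ω σ (Set.Iic (2 * q i)) (phaseStart q k + s : ℕ) / (2 * q i) := by
    refine Finset.sum_le_sum fun i hi => ?_
    have hik := Finset.mem_range.1 hi
    have hqi := hq0 i
    have h3 := hσ.backlog_phases hq hN hω' hY' hq8 hanti (show i ≤ k - 1 by omega)
      (show k - 1 < k by omega) (hunit i hik)
    rw [show k - 1 + 1 = k by omega] at h3
    have h4 := hσ.backlog_stream (C := Set.Iic (2 * q i : ℝ))
      (by rw [Set.mem_Iic]; linarith) hω (Nat.zero_le s) hs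
    rw [add_zero] at h4
    rw [le_div_iff₀ (by positivity)]
    have h5 : 0 ≤ (N : ℝ) * q (k - 1) := by positivity
    have h6 : 0 ≤ (N : ℝ) * q i := by positivity
    -- The surviving fraction is `1 / 4 - 1 / 21 ≥ 1 / 6`, hence `N / 12` after division by `2 * q
    -- i`.
    linarith
  rw [Finset.sum_const, Finset.card_range, nsmul_eq_mul] at h2
  linarith

end Phases

/-! ### The bound in terms of `ln α` -/

theorem OnlineAlgorithm.phases_bound {N : ℕ} (hN : 2 ≤ N) (A : OnlineAlgorithm N) {α β : ℝ}
    (hα : 1 ≤ α) (hβ : 0 ≤ β) (hβα : β ≤ α) {k : ℕ} {q : ℕ → ℕ} (hq : ∀ j, 0 < q j)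
    (hqα : ∀ j, (2 * q j : ℝ) ≤ α) (hqk : ∀ j, k ≤ q j)
    (hq8 : ∀ j, j + 1 < k → q j = 8 * q (j + 1)) (hanti : ∀ i j, i < j → j < k → q j < q i) :
    ((k / 144 : ℝ) : EReal) ≤ A.competitiveRatio α β := by
  have hN0 : 0 < N := by omega
  have hN' : (0 : ℝ) < N := by exact_mod_cast hN0
  have hB : N * k / 24 / (6 * N) = (k / 144 : ℝ) := by
    field_simp
    ring
  -- Test instances ending with phase `i`: the adversary's decision is read off from them and
  -- carried over to the actual instance by causality.
  let base : ℕ → Instance := fun i => ⟨phases N q hq (i + 1), by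
    have := (hq i).ne'
    simp [phases, hN0.ne', this], phases_sorted N hq (i + 1)⟩
  by_cases hcase : ∃ i < k, (N * q i / 12 : ℝ) ≤
      backlog (base i) (A.schedule (base i)) (Set.Iic 1) (phaseStart q i + q i : ℕ)
  · obtain ⟨i, hi, hback⟩ := hcase
    have hjobs : (phasesPlan N q hq i ++ gridPlan (phaseStart q i) 0 (q i) (N * q i)).map Entry.job
        ++ List.replicate (N / 2) (longJob q hq i) = phases N q hq (i + 1) := by
      rw [List.map_append, map_job_phasesPlan, map_job_gridPlan, phases, List.append_assoc]
    have hmem : ∀ J ∈ (phasesPlan N q hq i ++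
        gridPlan (phaseStart q i) 0 (q i) (N * q i)).map Entry.job,
        J ∈ phases N q hq (i + 1) := by
      intro J hJ
      rw [← hjobs]
      exact List.mem_append_left _ hJ
    -- Stop at half-time of phase `i`: the offline plan has spent `q i` on the `N * q i` unit jobs
    -- with all `N` machines and postpones the `N / 2` long jobs. The algorithm's unit backlog is of
    -- order `N * q i ≥ N * k`.
    have hend := A.endgame hN0 hα hβ hβα (J := longJob q hq i) (n := N / 2)
      (T := phaseStart q i + q i) (K := 0) (B := N * k / 24) (Nat.div_le_self _ _)
      ((fits_phasesPlan N hq i).append (fits_gridPlan (phaseStart q i) 0 (q i) (N * q i) (hq i)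
        (fun u hu => by
          rw [zero_add]
          exact (Nat.div_lt_iff_lt_mul (hq i)).2 hu)) (Nat.cast_nonneg _) (by simp))
      (fun J hJ => phases_admissible N hq hα hqα (hmem J hJ))
      (singleJob_admissible _ _ _ (by
        have : (1 : ℝ) ≤ q i := by exact_mod_cast hq i
        linarith) (hqα i) (by simp))
      (fun J hJ => by
        obtain ⟨j, hj, e⟩ := release_of_mem_phases N hq (hmem J hJ)
        rw [e, longJob_release]
        exact_mod_cast phaseStart_mono q (Nat.lt_succ_iff.1 hj))
      (by rw [longJob_release]; simp)
      (by
        have := phases_sorted N hq (i + 1)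
        rw [← hjobs] at this
        exact (List.pairwise_append.1 this).1)
      (by positivity) ?_
    · rwa [hB] at hend
    intro L ω Y hY hω t ht1 ht2
    rw [hjobs] at hω
    have hσ := A.feasible ω
    have hagree := A.backlog_eq_of_append (ω := ω) (ω' := base i) (X := phases N q hq (i + 1))
      (Y := stream N (phaseStart q i + q i) L ++ Y) (Y' := []) (t := (phaseStart q i + q i : ℕ))
      (by rw [hω, List.append_assoc]) (by simp [base]) (by
        intro J hJ
        rcases List.mem_append.1 hJ with h | h
        · obtain ⟨s, -, rfl⟩ := mem_stream h
          rw [unitJob_release]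
          exact_mod_cast by omega
        · refine le_trans ?_ (hY J h)
          exact_mod_cast by omega) (by simp) (Set.Iic 1)
    rw [← hagree] at hback
    have hstream := hσ.backlog_stream (C := Set.Iic 1) (by simp) hω
      (Nat.zero_le (t - (phaseStart q i + q i))) (by omega)
    rw [add_zero, show phaseStart q i + q i + (t - (phaseStart q i + q i)) = t by omega] at hstream
    refine le_trans ?_ (hback.trans (hstream.trans (hσ.backlog_le_pending t)))
    have h1 : (k : ℝ) ≤ q i := by exact_mod_cast hqk i
    have h2 := mul_le_mul_of_nonneg_left h1 hN'.le
    have h3 : (0 : ℝ) ≤ N * k := by positivity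
    linarith
  · push Not at hcase
    -- All phases are played and the offline plan has nothing left over: `n = 0`, and `J` is a
    -- dummy.
    have hend := A.endgame hN0 hα hβ hβα (X := phasesPlan N q hq k)
      (J := unitJob (phaseStart q k)) (n := 0)
      (T := phaseStart q k) (K := 0) (B := N * k / 24) (Nat.zero_le _) (fits_phasesPlan N hq k)
      (fun J hJ => phases_admissible N hq hα hqα (map_job_phasesPlan N hq k ▸ hJ))
      (unitJob_admissible hα _)
      (fun J hJ => release_le_of_mem_phases N hq (map_job_phasesPlan N hq k ▸ hJ))
      le_rfl (by rw [map_job_phasesPlan]; exact phases_sorted N hq k) (by positivity) ?_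
    · rwa [hB] at hend
    intro L ω Y hY hω t ht1 ht2
    rw [map_job_phasesPlan, List.replicate_zero, List.append_nil] at hω
    have h := (A.feasible ω).pending_of_phases hq hN hω hY hq8 hanti (fun i hi => by
      refine lt_of_eq_of_lt ?_ (hcase i hi)
      obtain ⟨Y', e, hY'⟩ := phases_prefix N hq (Nat.succ_le_of_lt hi)
      have hle : ((phaseStart q i + q i : ℕ) : ℝ) ≤ phaseStart q (i + 1) := by
        rw [phaseStart]
        exact_mod_cast by omega
      refine A.backlog_eq_of_append (X := phases N q hq (i + 1))
        (Y := Y' ++ stream N (phaseStart q k) L ++ Y) (Y' := []) ?_ (by simp [base]) ?_ (by simp) _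
      · rw [hω, e]
        simp only [List.append_assoc, Nat.succ_eq_add_one]
      · intro J hJ
        refine hle.trans ?_
        rcases List.mem_append.1 hJ with h | h
        · rcases List.mem_append.1 h with h | h
          · exact hY' J h
          · obtain ⟨s, -, rfl⟩ := mem_stream h
            rw [unitJob_release]
            have := phaseStart_mono q (Nat.succ_le_of_lt hi)
            exact_mod_cast by rw [Nat.succ_eq_add_one] at this; omega
        · refine le_trans ?_ (hY J h)
          have := phaseStart_mono q (Nat.succ_le_of_lt hi)
          exact_mod_cast by rw [Nat.succ_eq_add_one] at this; omega)
      (s := t - phaseStart q k) (by omega)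
    rwa [show phaseStart q k + (t - phaseStart q k) = t by omega] at h

theorem OnlineAlgorithm.log_bound {N : ℕ} (hN : 2 ≤ N) (A : OnlineAlgorithm N) {α β : ℝ}
    (hα : 1 ≤ α) (hβ : 0 ≤ β) (hβα : β ≤ α) (hlog : 3 ≤ Real.log α) :
    ((Real.log α / 864 : ℝ) : EReal) ≤ A.competitiveRatio α β := by
  set k := ⌊Real.log α / 3⌋₊ with hk
  have hk1 : 1 ≤ k := Nat.le_floor (by push_cast; linarith)
  have hkle : (k : ℝ) ≤ Real.log α / 3 := Nat.floor_le (by linarith)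
  have hklt : Real.log α / 3 < k + 1 := Nat.lt_floor_add_one _
  -- The longest job has size `2 * q 0`. It fits because `2 * k * 8 ^ (k - 1) ≤ 16 ^ k`, `16 ≤ exp
  -- 3` and `3 * k ≤ log α`.
  have hmax : (2 * (k * 8 ^ (k - 1) : ℕ) : ℝ) ≤ α := by
    have h1 : 2 * (k * 8 ^ (k - 1)) ≤ 16 ^ k := by
      obtain ⟨m, hm⟩ := Nat.exists_eq_add_of_le' hk1
      have h2 : m + 1 < 2 ^ (m + 1) := Nat.lt_two_pow_self
      have h3 : 16 ^ (m + 1) = 4 * (2 * (2 ^ (m + 1) * 8 ^ m)) := by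
        rw [show 16 = 2 * 8 by norm_num, mul_pow, pow_succ 8 m]
        ring
      have h4 := Nat.mul_le_mul_right (8 ^ m) h2.le
      rw [hm, h3, Nat.add_sub_cancel]
      omega
    calc (2 * (k * 8 ^ (k - 1) : ℕ) : ℝ) ≤ 16 ^ k := by exact_mod_cast h1
      _ ≤ (Real.exp 3) ^ k := by
        gcongr
        have h5 := Real.exp_one_gt_d9
        rw [show (3 : ℝ) = (3 : ℕ) * 1 by norm_num, Real.exp_nat_mul]
        calc (16 : ℝ) ≤ 2.7 ^ 3 := by norm_num
          _ ≤ _ := by gcongr; linarith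
      _ = Real.exp (k * 3) := (Real.exp_nat_mul 3 k).symm
      _ ≤ Real.exp (Real.log α) := Real.exp_le_exp.2 (by linarith)
      _ = α := Real.exp_log (by linarith)
  -- The factor `k` in `q` guarantees `k ≤ q j` even in the shortest phase; truncated subtraction
  -- gives `q j = k` beyond the last phase.
  refine le_trans ?_ (A.phases_bound hN hα hβ hβα (k := k) (q := fun j => k * 8 ^ (k - 1 - j))
    (fun j => by positivity) (fun j => ?_) (fun j => Nat.le_mul_of_pos_right _ (by positivity))
    (fun j hj => ?_) (fun i j hij hj => ?_))
  · refine EReal.coe_le_coe_iff.2 ?_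
    have : (1 : ℝ) ≤ k := by exact_mod_cast hk1
    -- Since `k ≥ 1`, `log α / 3 < k + 1 ≤ 2 * k`, whence `864 = 144 * 6`.
    linarith
  · refine le_trans ?_ hmax
    have : k * 8 ^ (k - 1 - j) ≤ k * 8 ^ (k - 1) :=
      Nat.mul_le_mul_left _ (Nat.pow_le_pow_right (by norm_num) (Nat.sub_le _ _))
    exact_mod_cast Nat.mul_le_mul_left 2 this
  · rw [show k - 1 - j = (k - 1 - (j + 1)) + 1 by omega, pow_succ]
    ring
  · exact Nat.mul_lt_mul_of_pos_left (Nat.pow_lt_pow_right (by norm_num) (by omega)) hk1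

end MPMS

end

theorem mainTheorem3 (ε : ℝ) (hε : 0 < ε) :
    ∃ c : ℝ, 0 < c ∧
      ∀ (N : ℕ), 2 ≤ N →
      ∀ (A : MPMS.OnlineAlgorithm N), A.WorkConserving →
      ∀ (α β : ℝ), 1 ≤ α → 0 ≤ β → β ≤ α → (1 ≤ β ∨ ε ≤ 1) →
        ((c * (Real.log α + β ^ (1 - ε)) : ℝ) : EReal) ≤ A.competitiveRatio α β := by
  -- The sum is at most `864 * a + 18 * b` for two lower bounds `a`, `b` of the ratio, hence at most
  -- `882 * max a b`.
  refine ⟨1 / 900, by norm_num, fun N hN A hA α β hα hβ hβα hε1 => ?_⟩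
  have hone : ((1 : ℝ) : EReal) ≤ A.competitiveRatio α β := A.one_le_competitiveRatio hα hβ hβα
  have hlog0 : 0 ≤ Real.log α := Real.log_nonneg hα
  have hpow : β ^ (1 - ε) ≤ max 1 β := by
    rcases le_or_gt 1 β with h | h
    · refine le_trans ?_ (le_max_right _ _)
      calc β ^ (1 - ε) ≤ β ^ (1 : ℝ) := Real.rpow_le_rpow_of_exponent_le h (by linarith)
        _ = β := Real.rpow_one β
    · refine le_trans ?_ (le_max_left _ _)
      -- For `β < 1` a negative exponent would make the power unbounded near 0; this is where the
      -- side condition enters.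
      have : ε ≤ 1 := hε1.resolve_left (not_le.2 h)
      exact Real.rpow_le_one hβ h.le (by linarith)
  obtain ⟨a, ha, ha1, hlog⟩ : ∃ a : ℝ, (a : EReal) ≤ A.competitiveRatio α β ∧ 0 ≤ a ∧
      Real.log α ≤ 864 * a := by
    rcases le_or_gt 3 (Real.log α) with h | h
    · exact ⟨_, A.log_bound hN hα hβ hβα h, by positivity, by linarith⟩
    · exact ⟨1, hone, zero_le_one, by linarith⟩
  obtain ⟨b, hb, hb1, hpow'⟩ : ∃ b : ℝ, (b : EReal) ≤ A.competitiveRatio α β ∧ 0 ≤ b ∧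
      β ^ (1 - ε) ≤ 18 * b := by
    rcases le_or_gt 2 β with h | h
    · refine ⟨_, hA.beta_bound (by omega) h hβα, by positivity, hpow.trans ?_⟩
      exact max_le (by linarith) (by linarith)
    · exact ⟨1, hone, zero_le_one, hpow.trans (max_le (by norm_num) (by linarith))⟩
  rcases le_total a b with h | h
  · exact (EReal.coe_le_coe_iff.2 (by linarith)).trans hb
  · exact (EReal.coe_le_coe_iff.2 (by linarith)).trans ha
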